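/- **Conventions.** Let $A,B,C$ be finite-dimensional complex vector spaces. A tensor in $A\otimes B\otimes C$ has rank at most $r$ if it is a sum of $r$ tensors $a\otimes b\otimes c$, and border rank at most $r$ if it lies in the closure of the set of tensors of rank at most $r$. For $T\in A\otimes B\otimes C$ let $$T_A^{\wedge p}:\Lambda^pA\otimes B^*\to\Lambda^{p+1}A\otimes C$$ be the linear map, linear in $T$, that for $T=a\otimes b\otimes c$ sends $\omega\otimes\beta$ to $\beta(b)\,(\omega\wedge a)\otimes c$. When $\dim\Lambda^pA\otimes B^*\le\dim\Lambda^{p+1}A\otimes C$, its maximal minors (in the bases induced by bases of $A,B,C$) are the minors of size $\dim \Lambda^pA\otimes B^*$; they are polynomials in the coordinates of $T$. For $m,p\ge 0$ let $a_{-p},\dots,a_p$, $b_1,\dots,b_m$, $c_1,\dots,c_m$ be the standard bases of $\mathbb C^{2p+1},\mathbb C^m,\mathbb C^m$. For complex parameters $\lambda=(\lambda_{k,\alpha})_{1\le k\le p,\,1\le\alpha\le m-k}$ put $$X_j=\sum_{\beta=1}^{m-j}b_\beta\otimes c_{j+\beta}\ (0\le j\le p),\qquad X_{-k}=\sum_{\alpha=1}^{m-k}\lambda_{k,\alpha}\,b_{k+\alpha}\otimes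 c_\alpha\ (1\le k\le p),$$ viewed as $m\times m$ matrices (rows indexed by the $b$'s, columns by the $c$'s), $T_{m,p}(\lambda)=\sum_{j=-p}^{p}a_j\otimes X_j$, and $T_m(\lambda)=T_{m,p}(\lambda)$ when $m=2p+1$. Let $([X_i,X_j])$ be the $2mp\times 2mp$ block matrix of commutators, $i,j\in\{-p,\dots,-1,1,\dots,p\}$. Set $\lambda_{k,\alpha}=0$ outside the range $1\le k\le p$, $1\le \alpha\le m-k$, and define the square matrices of size at most $p$ $$D_d(\lambda)=\bigl(\lambda_{k,d}-\lambda_{k,d+i}\bigr)_{k,i},\qquad U_s(\lambda)=\bigl(\lambda_{k,s-k}-\lambda_{k,s-k-i}\bigr)_{i,k},$$ where in $D_d$ the indices $k,i$ run over all $t\in\{1,\dots,p\}$ with $1\le d+t\le m$, and in $U_s$ over all $t\in\{1,\dots,p\}$ with $1\le s-t\le m$. **Theorem.** 1. Let $m=2p+1$ be odd. The maximal minors of $T_A^{\wedge p}$ vanish on all tensors $T\in\mathbb C^m\otimes\mathbb C^m\otimes\mathbb C^m$ of border rank at most $r$, for every $r\le 2m-2$, and they are not identically zero on $\mathbb C^m\otimes\mathbb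 C^m\otimes\mathbb C^m$. 2. Let $m=2p+2$ be even. The maximal minors of $T_A^{\wedge p}$ vanish on all tensors $T\in\mathbb C^m\otimes\mathbb C^m\otimes\mathbb C^m$ of border rank at most $r$, for every $r\le 2m-4$, and they are not all identically zero on $\mathbb C^m\otimes\mathbb C^m\otimes\mathbb C^m$. 3. Let $m=2p+1$. For all $\lambda$, $$\det([X_i,X_j])=(-1)^p\prod_{d=1-p}^{m-1}\det D_d(\lambda)\ \prod_{s=2}^{m+p}\det U_s(\lambda).$$ Moreover, for generic $\lambda$ (that is, for all $\lambda$ outside the zero set of some nonzero polynomial), every $\det D_d(\lambda)$ ($1-p\le d\le m-1$) and every $\det U_s(\lambda)$ ($2\le s\le m+p$) is nonzero, so that $\det([X_i,X_j])\neq0$, and the maximal minors of $T_A^{\wedge p}$ do not vanish at $T=T_m(\lambda)$. -/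

import Mathlib

open scoped TensorProduct

noncomputable section

/-! ### Tensors, rank and border rank -/

/-- The space `A ⊗ B ⊗ C` with `A = ℂ^a`, `B = ℂ^b`, `C = ℂ^c`. -/
abbrev TensorSpace (a b c : ℕ) : Type :=
  (Fin a → ℂ) ⊗[ℂ] ((Fin b → ℂ) ⊗[ℂ] (Fin c → ℂ))

/-- The coordinates of a tensor in the basis formed by the products of standard basis vectors. -/
def tensorCoords (a b c : ℕ) : TensorSpace a b c ≃ₗ[ℂ] (Fin a × Fin b × Fin c → ℂ) :=
  ((Pi.basisFun ℂ (Fin a)).tensorProduct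
    ((Pi.basisFun ℂ (Fin b)).tensorProduct (Pi.basisFun ℂ (Fin c)))).equivFun

/-- The set of tensors of rank at most `r`: the sums of `r` tensors `a ⊗ b ⊗ c`. -/
def rankLE (a b c r : ℕ) : Set (TensorSpace a b c) :=
  {T | ∃ (x : Fin r → Fin a → ℂ) (y : Fin r → Fin b → ℂ) (z : Fin r → Fin c → ℂ),
    T = ∑ i, x i ⊗ₜ[ℂ] (y i ⊗ₜ[ℂ] z i)}

/-- The set of tensors of border rank at most `r`: the closure of the set of tensors of rank at
most `r` in the Euclidean topology of `A ⊗ B ⊗ C`, that is, the topology of the coordinates. -/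
def borderRankLE (a b c r : ℕ) : Set (TensorSpace a b c) :=
  tensorCoords a b c ⁻¹' closure (tensorCoords a b c '' rankLE a b c r)

/-! ### The Young flattening -/

section Flattening

variable {A B C : Type*} [AddCommGroup A] [Module ℂ A] [AddCommGroup B] [Module ℂ B]
  [AddCommGroup C] [Module ℂ C]

/-- `a ↦ (ω ↦ ω ∧ a)`, as a map from `A` to the linear maps from `Λ^p A` to `Λ^(p+1) A`. -/
def wedgeRight (A : Type*) [AddCommGroup A] [Module ℂ A] (p : ℕ) :
    A →ₗ[ℂ] (⋀[ℂ]^p A →ₗ[ℂ] ⋀[ℂ]^(p + 1) A) :=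
  LinearMap.mk₂ ℂ
    (fun a ω => ⟨(ω : ExteriorAlgebra ℂ A) * ExteriorAlgebra.ι ℂ a, by
      rw [ExteriorAlgebra.exteriorPower, pow_succ]
      exact Submodule.mul_mem_mul ω.2 (LinearMap.mem_range_self _ a)⟩)
    (fun a a' ω => Subtype.ext (by simp [mul_add]))
    (fun t a ω => Subtype.ext (by simp))
    (fun a ω ω' => Subtype.ext (by simp [add_mul]))
    (fun t a ω => Subtype.ext (by simp))

/-- The Young flattening `T ↦ T_A^{∧p}`, where
`T_A^{∧p} : Λ^p A ⊗ B* → Λ^(p+1) A ⊗ C` is the composition of `Id ⊗ T : Λ^p A ⊗ B* → Λ^p A ⊗ A ⊗ C`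
with the skew-symmetrization `Λ^p A ⊗ A → Λ^(p+1) A`. It is linear in `T`; its value at a tensor
`a ⊗ b ⊗ c` is given by `youngFlattening_tmul`. -/
def youngFlattening (A B C : Type*) [AddCommGroup A] [Module ℂ A] [AddCommGroup B] [Module ℂ B]
    [AddCommGroup C] [Module ℂ C] (p : ℕ) :
    A ⊗[ℂ] (B ⊗[ℂ] C) →ₗ[ℂ]
      (⋀[ℂ]^p A ⊗[ℂ] Module.Dual ℂ B →ₗ[ℂ] ⋀[ℂ]^(p + 1) A ⊗[ℂ] C) :=
  TensorProduct.homTensorHomMap (RingHom.id ℂ) _ _ _ _ ∘ₗ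
    TensorProduct.map (wedgeRight A p)
      (dualTensorHom ℂ (Module.Dual ℂ B) C ∘ₗ
        TensorProduct.map (Module.Dual.eval ℂ B) LinearMap.id)

theorem youngFlattening_tmul (p : ℕ) (a : A) (b : B) (c : C) (ω : ⋀[ℂ]^p A)
    (β : Module.Dual ℂ B) :
    youngFlattening A B C p (a ⊗ₜ (b ⊗ₜ c)) (ω ⊗ₜ β) = wedgeRight A p a ω ⊗ₜ (β b • c) := by
  simp [youngFlattening]

end Flattening

/-- The index set of the basis of `Λ^p A ⊗ B*`. -/
abbrev FlatCol (a b p : ℕ) : Type := Set.powersetCard (Fin a) p × Fin b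

/-- The index set of the basis of `Λ^(p+1) A ⊗ C`. -/
abbrev FlatRow (a c p : ℕ) : Type := Set.powersetCard (Fin a) (p + 1) × Fin c

/-- The standard basis of `ℂ^n`. -/
abbrev stdBasis (n : ℕ) : Module.Basis (Fin n) ℂ (Fin n → ℂ) := Pi.basisFun ℂ (Fin n)

/-- The matrix of `T_A^{∧p}` in the bases induced by the standard bases of `A`, `B`, `C`. -/
def flatMatrix {a b c : ℕ} (p : ℕ) (T : TensorSpace a b c) :
    Matrix (FlatRow a c p) (FlatCol a b p) ℂ :=
  LinearMap.toMatrix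
    (((stdBasis a).exteriorPower p).tensorProduct (stdBasis b).dualBasis)
    (((stdBasis a).exteriorPower (p + 1)).tensorProduct (stdBasis c))
    (youngFlattening _ _ _ p T)

/-- The maximal minor of `T_A^{∧p}` in the rows chosen by `f` (and in all the columns), for formats
with at most as many columns as rows. -/
def maximalMinor {a b c : ℕ} (p : ℕ) (T : TensorSpace a b c)
    (f : FlatCol a b p ↪ FlatRow a c p) : ℂ :=
  ((flatMatrix p T).submatrix f id).det

/-! ### The tensors `T_{m,p}(λ)` -/

/-- The index set of the parameters `λ_{k,α}`, `1 ≤ k ≤ p`, `1 ≤ α ≤ m - k`. -/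
abbrev LambdaIndex (m p : ℕ) : Type :=
  {x : ℤ × ℤ // (1 ≤ x.1 ∧ x.1 ≤ p) ∧ 1 ≤ x.2 ∧ x.1 + x.2 ≤ m}

/-- The parameter `λ_{k,α}`, read as `0` outside the range `1 ≤ k ≤ p`, `1 ≤ α ≤ m - k`. -/
def lam {m p : ℕ} (l : LambdaIndex m p → ℂ) (k α : ℤ) : ℂ :=
  if h : (1 ≤ k ∧ k ≤ p) ∧ 1 ≤ α ∧ k + α ≤ m then l ⟨(k, α), h⟩ else 0

/-- The matrices `X_j`, `-p ≤ j ≤ p`. For `j ≥ 0`, `X_j = ∑_{β=1}^{m-j} b_β ⊗ c_{j+β}`, and for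
`k = -j > 0`, `X_{-k} = ∑_{α=1}^{m-k} λ_{k,α} b_{k+α} ⊗ c_α`. The rows belong to the `b`'s and the
columns to the `c`'s, and the index `i : Fin m` stands for `i + 1`. -/
def sliceX {m p : ℕ} (l : LambdaIndex m p → ℂ) (j : ℤ) : Matrix (Fin m) (Fin m) ℂ :=
  Matrix.of fun b c =>
    if (c : ℤ) = b + j then (if 0 ≤ j then 1 else lam l (-j) (c + 1)) else 0

/-- `T_{m,p}(λ) = ∑_{j=-p}^{p} a_j ⊗ X_j` in `ℂ^{2p+1} ⊗ ℂ^m ⊗ ℂ^m`. The basis vector `a_j` of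
`A = ℂ^{2p+1}` is the standard basis vector with (zero-based) number `j + p`. -/
def tensorT {m p : ℕ} (l : LambdaIndex m p → ℂ) : TensorSpace (2 * p + 1) m m :=
  ∑ i : Fin (2 * p + 1), stdBasis (2 * p + 1) i ⊗ₜ[ℂ]
    ∑ b : Fin m, ∑ c : Fin m,
      sliceX l ((i : ℤ) - p) b c • (stdBasis m b ⊗ₜ[ℂ] stdBasis m c)

/-- The index set `{-p, …, -1, 1, …, p}` of the blocks of the commutator matrix. -/
abbrev BlockIndex (p : ℕ) : Type := ↥((Finset.Icc (-(p : ℤ)) p).erase 0)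

/-- The `2mp × 2mp` block matrix `([X_i, X_j])`, `i, j ∈ {-p, …, -1, 1, …, p}`. -/
def commutatorMatrix {m p : ℕ} (l : LambdaIndex m p → ℂ) :
    Matrix (BlockIndex p × Fin m) (BlockIndex p × Fin m) ℂ :=
  Matrix.of fun x y => ⁅sliceX l x.1, sliceX l y.1⁆ x.2 y.2

/-- The first family of small matrices: for `1 - p ≤ d ≤ m - 1`, the matrix with entries
`λ_{k,d} - λ_{k,d+i}`, whose row and column indices `k` and `i` run over the
`t ∈ {1, …, p}` with `1 ≤ d + t ≤ m`. -/
def smallD {m p : ℕ} (l : LambdaIndex m p → ℂ) (d : ℤ) :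
    Matrix ↥(Finset.Icc (max 1 (1 - d)) (min (p : ℤ) (m - d)))
      ↥(Finset.Icc (max 1 (1 - d)) (min (p : ℤ) (m - d))) ℂ :=
  Matrix.of fun k i => lam l k d - lam l k (d + i)

/-- The second family of small matrices: for `2 ≤ s ≤ m + p`, the matrix with entries
`λ_{k,s-k} - λ_{k,s-k-i}`, whose row and column indices `i` and `k` run over the
`t ∈ {1, …, p}` with `1 ≤ s - t ≤ m`. -/
def smallU {m p : ℕ} (l : LambdaIndex m p → ℂ) (s : ℤ) :
    Matrix ↥(Finset.Icc (max 1 (s - m)) (min (p : ℤ) (s - 1)))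
      ↥(Finset.Icc (max 1 (s - m)) (min (p : ℤ) (s - 1))) ℂ :=
  Matrix.of fun i k => lam l k (s - k) - lam l k (s - k - i)

end

/-!
Write `a_j` for the basis of `A = ℂ^{2p+1}` and let `m = 2p + 1`.

*Vanishing.* Right multiplication by a vector `a` factors through the exterior power of a hyperplane,
so a tensor of rank one has a Young flattening of rank at most `C(dim A - 1, p)`, and a tensor of
rank `r` one of rank at most `r C(dim A - 1, p)`. For the given values of `r` this is smaller than
the number of columns, and the vanishing of a minor is a closed condition
(`maximalMinor_eq_zero_of_borderRank`).

*Toeplitz windows.* The entry in row `b` and column `c` of `T_m(λ)` is a multiple of `a_{c-b}`. Let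
`S` be the nilpotent translation `a_j ↦ a_{j+1}` and let `Φ_u` be the coefficients of `Λ(1 - y S)`.
The sums `∑_c Φ_{n-c} a_{c-b}` telescope, and together with contractions they invert the flattening
of a Toeplitz block with `p + 1` columns (`WindowFrame.sum_coeff_cut_wedge`). For `m = 2p + 2`, two
diagonal Toeplitz blocks of size `p + 1` therefore give a tensor with injective flattening.

*The tensors `T_m(λ)`.* For `m = 2p + 1` the two blocks `b, c ≤ p` and `p ≤ b, c` overlap. Let
`λ_{k,α} = 1 + t (k + α - 1)` inside the blocks and `0` outside, so that the flattening is
`F₀ + t F₁`. Here `F₀` may have a kernel, but no nonzero `ξ` in it extends to a solution of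
`(F₀ + t F₁)(ξ + t η) = O(t²)` (`WindowFrame.overlap_injective`). A kernel vector `ξ` of `F₀` is
determined by the element `z = ∑_{b ≤ p} a_{p-b} ξ_b` of `Λ^{p+1} A`, which satisfies `a_0^* z = 0`.
Applying `∑_q a_0^* a_q^* ∑_c Φ_{p+q-c}` to the first order equation removes `η` by telescoping,
and Newton's identity (`WindowFrame.smul_coeff_eq`) turns the rest into
`p ∑_q a_{-q}^* a_q^* z = 0`. So `z` is killed by the lowering operator of the Lefschetz `sl₂` of the
symplectic space spanned by the `a_j`, `j ≠ 0`; since `z` lies above the middle degree, `z = 0`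
(`WindowFrame.eq_zero_of_lower_eq_zero`). A pencil of square matrices with this first order property
has a nonzero determinant (`exists_injective_pencil`).

*The commutators.* The matrices `X_j` with `j ≥ 0` commute, so that the determinant of the commutator
matrix is, up to sign, the product of the determinants of the blocks `[X_{-k}, X_i]` and
`[X_i, X_{-k}]`. The nonzero entries of `[X_i, X_{-k}]` lie on the diagonal `c = b + i - k`, so that
the two blocks decompose further according to `b + 1 - k = c + 1 - i` and `b + 1 + i = c + 1 + k`,
with the matrices `D_d` and `U_s` as the pieces. Each of these has a nonzero determinant for a suitable
choice of `λ`; a product of nonzero polynomials then describes the generic `λ`.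
-/

/-! ### Telescoping sums over integer intervals -/

theorem sum_Icc_int_telescope {M : Type*} [AddCommGroup M] (f : ℤ → M) {a b : ℤ} (h : a ≤ b + 1) :
    ∑ c ∈ Finset.Icc a b, (f c - f (c + 1)) = f a - f (b + 1) := by
  obtain ⟨n, hn⟩ := Int.eq_ofNat_of_zero_le (sub_nonneg.2 h)
  obtain rfl : b = a + n - 1 := by omega
  clear h hn
  induction n with
  | zero => rw [Finset.Icc_eq_empty (by simp)]; simp
  | succ n ih =>
    have : Finset.Icc a (a + (n + 1 : ℕ) - 1) = insert (a + n) (Finset.Icc a (a + n - 1)) := by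
      ext x; simp only [Finset.mem_Icc, Finset.mem_insert]; push_cast; omega
    rw [this, Finset.sum_insert (by simp), ih]
    push_cast
    rw [show a + (n : ℤ) - 1 + 1 = a + n by ring,
      show a + ((n : ℤ) + 1) - 1 + 1 = a + n + 1 by ring]
    abel

/-! ### Operators on the exterior algebra -/

section Operators

variable {K V : Type*} [Field K] [AddCommGroup V] [Module K V]

/-- Contraction of an element of the exterior algebra with a linear form, as a linear map. -/
noncomputable abbrev contract (f : Module.Dual K V) :
    ExteriorAlgebra K V →ₗ[K] ExteriorAlgebra K V :=
  CliffordAlgebra.contractLeft (Q := (0 : QuadraticForm K V)) f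

theorem contract_ι_mul (f : Module.Dual K V) (v : V) (x : ExteriorAlgebra K V) :
    contract f (ExteriorAlgebra.ι K v * x) = f v • x - ExteriorAlgebra.ι K v * contract f x :=
  CliffordAlgebra.contractLeft_ι_mul f v x

theorem contract_comm (f g : Module.Dual K V) (x : ExteriorAlgebra K V) :
    contract f (contract g x) = -contract g (contract f x) :=
  CliffordAlgebra.contractLeft_comm f g x

theorem contract_self (f : Module.Dual K V) (x : ExteriorAlgebra K V) :
    contract f (contract f x) = 0 :=
  CliffordAlgebra.contractLeft_contractLeft f x

theorem contract_algebraMap (f : Module.Dual K V) (r : K) :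
    contract f (algebraMap K (ExteriorAlgebra K V) r) = 0 :=
  CliffordAlgebra.contractLeft_algebraMap (0 : QuadraticForm K V) f r

theorem ι_mul_ι_mul_comm (v w : V) (x : ExteriorAlgebra K V) :
    ExteriorAlgebra.ι K v * (ExteriorAlgebra.ι K w * x) =
      -(ExteriorAlgebra.ι K w * (ExteriorAlgebra.ι K v * x)) := by
  rw [← mul_assoc, ← mul_assoc, eq_neg_of_add_eq_zero_left (ExteriorAlgebra.ι_add_mul_swap v w),
    neg_mul]

theorem ι_mul_mem_exteriorPower (v : V) {n : ℕ} {x : ExteriorAlgebra K V} (hx : x ∈ ⋀[K]^n V) :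
    ExteriorAlgebra.ι K v * x ∈ ⋀[K]^(n + 1) V := by
  rw [ExteriorAlgebra.exteriorPower, pow_succ']
  exact Submodule.mul_mem_mul (LinearMap.mem_range_self _ v) hx

/-- Induction on elements of an exterior power, through left multiplication by vectors. -/
theorem exteriorPower_induction {C : ℕ → ExteriorAlgebra K V → Prop}
    (algebraMap : ∀ r : K, C 0 (algebraMap K _ r))
    (add : ∀ n x y, x ∈ ⋀[K]^n V → y ∈ ⋀[K]^n V → C n x → C n y → C n (x + y))
    (ι_mul : ∀ n v x, x ∈ ⋀[K]^n V → C n x → C (n + 1) (ExteriorAlgebra.ι K v * x))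
    {n : ℕ} {x : ExteriorAlgebra K V} (hx : x ∈ ⋀[K]^n V) : C n x := by
  refine Submodule.pow_induction_on_left' (LinearMap.range (ExteriorAlgebra.ι K (M := V)))
    (C := fun n x _ => C n x) algebraMap (fun x y n hx hy => add n x y hx hy) ?_ hx
  rintro _ ⟨v, rfl⟩ n x hx h
  exact ι_mul n v x hx h

theorem contract_mem_exteriorPower (f : Module.Dual K V) {n : ℕ} {x : ExteriorAlgebra K V}
    (hx : x ∈ ⋀[K]^(n + 1) V) : contract f x ∈ ⋀[K]^n V := by
  have key : ∀ {n : ℕ} {x : ExteriorAlgebra K V}, x ∈ ⋀[K]^n V →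
      (n = 0 → contract f x = 0) ∧ ∀ k, n = k + 1 → contract f x ∈ ⋀[K]^k V := by
    intro n x hx
    refine exteriorPower_induction (C := fun n x =>
      (n = 0 → contract f x = 0) ∧ ∀ k, n = k + 1 → contract f x ∈ ⋀[K]^k V)
      (fun r => ⟨fun _ => contract_algebraMap f r, fun k hk => by omega⟩) ?_ ?_ hx
    · intro n x y _ _ hx hy
      refine ⟨fun h => by rw [map_add, hx.1 h, hy.1 h, add_zero], fun k hk => ?_⟩
      rw [map_add]
      exact Submodule.add_mem _ (hx.2 k hk) (hy.2 k hk)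
    · intro n v x hmem hx
      refine ⟨fun h => by omega, fun k hk => ?_⟩
      obtain rfl : n = k := by omega
      rw [contract_ι_mul]
      refine Submodule.sub_mem _ (Submodule.smul_mem _ _ hmem) ?_
      cases n with
      | zero => rw [hx.1 rfl, mul_zero]; exact Submodule.zero_mem _
      | succ n => exact ι_mul_mem_exteriorPower v (hx.2 n rfl)
  exact (key hx).2 n rfl

theorem contract_eq_zero_of_mem_zero (f : Module.Dual K V) {x : ExteriorAlgebra K V}
    (hx : x ∈ ⋀[K]^0 V) : contract f x = 0 := by
  rw [ExteriorAlgebra.exteriorPower, pow_zero, Submodule.mem_one] at hx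
  obtain ⟨r, rfl⟩ := hx
  exact contract_algebraMap f r

theorem mul_ι_eq_smul (v : V) {n : ℕ} {x : ExteriorAlgebra K V} (hx : x ∈ ⋀[K]^n V) :
    x * ExteriorAlgebra.ι K v = (-1 : K) ^ n • (ExteriorAlgebra.ι K v * x) := by
  refine exteriorPower_induction (C := fun n x =>
    x * ExteriorAlgebra.ι K v = (-1 : K) ^ n • (ExteriorAlgebra.ι K v * x)) ?_ ?_ ?_ hx
  · intro r
    rw [pow_zero, one_smul, Algebra.commutes]
  · intro n x y _ _ hx hy
    rw [add_mul, hx, hy, mul_add, smul_add]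
  · intro n w x _ hx
    rw [mul_assoc, hx, mul_smul_comm, ι_mul_ι_mul_comm, smul_neg, pow_succ, mul_neg_one, neg_smul]

/-! ### The coefficients of `Λ(1 - y S)` -/

/-- The algebra map `Λ(1 - y S) : Λ V → (Λ V)[y]` attached to an endomorphism `S` of `V`; it sends
`v` to `v - y S v`. -/
noncomputable def oneSubHom (S : V →ₗ[K] V) :
    ExteriorAlgebra K V →ₐ[K] Polynomial (ExteriorAlgebra K V) :=
  ExteriorAlgebra.lift K
    ⟨{ toFun := fun v => Polynomial.C (ExteriorAlgebra.ι K v) -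
          Polynomial.X * Polynomial.C (ExteriorAlgebra.ι K (S v))
       map_add' := fun v w => by simp only [map_add, mul_add]; abel
       map_smul' := fun t v => by
        simp only [map_smul, ← Polynomial.smul_C, RingHom.id_apply, smul_sub, mul_smul_comm] },
      fun v => by
        have h := ExteriorAlgebra.ι_add_mul_swap (R := K) (S v) v
        simp only [LinearMap.coe_mk, AddHom.coe_mk, sub_mul, mul_sub]
        rw [← Polynomial.C_mul, ExteriorAlgebra.ι_sq_zero]
        rw [show Polynomial.X * Polynomial.C (ExteriorAlgebra.ι K (S v)) *
            (Polynomial.X * Polynomial.C (ExteriorAlgebra.ι K (S v))) =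
            Polynomial.X * Polynomial.X *
              Polynomial.C (ExteriorAlgebra.ι K (S v) * ExteriorAlgebra.ι K (S v)) by
          rw [Polynomial.C_mul, mul_assoc, ← mul_assoc (Polynomial.C _) Polynomial.X,
            ← Polynomial.X_mul_C, mul_assoc, mul_assoc],
          ExteriorAlgebra.ι_sq_zero, ← mul_assoc, ← Polynomial.X_mul_C, mul_assoc, mul_assoc,
          ← Polynomial.C_mul, ← Polynomial.C_mul]
        rw [map_zero, mul_zero, zero_sub, sub_zero, sub_eq_add_neg, ← neg_add, ← mul_add,
          ← Polynomial.C_add, h, map_zero, mul_zero, neg_zero]⟩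

theorem oneSubHom_ι_mul (S : V →ₗ[K] V) (v : V) (x : ExteriorAlgebra K V) :
    oneSubHom S (ExteriorAlgebra.ι K v * x) =
      Polynomial.C (ExteriorAlgebra.ι K v) * oneSubHom S x -
        Polynomial.X * (Polynomial.C (ExteriorAlgebra.ι K (S v)) * oneSubHom S x) := by
  rw [map_mul, oneSubHom, ExteriorAlgebra.lift_ι_apply, ← mul_assoc, ← sub_mul]
  rfl

/-- The coefficient of `y ^ u` in `Λ(1 - y S)`. The exponent is an integer; the coefficient is `0`
for `u < 0`. -/
noncomputable def shiftCoeff (S : V →ₗ[K] V) (u : ℤ) :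
    ExteriorAlgebra K V →ₗ[K] ExteriorAlgebra K V :=
  if 0 ≤ u then
    { toFun := fun x => (oneSubHom S x).coeff u.toNat
      map_add' := fun x y => by simp
      map_smul' := fun t x => by simp }
  else 0

theorem shiftCoeff_of_neg (S : V →ₗ[K] V) {u : ℤ} (hu : u < 0) (x : ExteriorAlgebra K V) :
    shiftCoeff S u x = 0 := by
  rw [shiftCoeff, if_neg (by omega), LinearMap.zero_apply]

theorem shiftCoeff_natCast (S : V →ₗ[K] V) (u : ℕ) (x : ExteriorAlgebra K V) :
    shiftCoeff S u x = (oneSubHom S x).coeff u := by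
  rw [shiftCoeff, if_pos (by omega)]
  rfl

theorem shiftCoeff_ι_mul (S : V →ₗ[K] V) (u : ℤ) (v : V) (x : ExteriorAlgebra K V) :
    shiftCoeff S u (ExteriorAlgebra.ι K v * x) =
      ExteriorAlgebra.ι K v * shiftCoeff S u x -
        ExteriorAlgebra.ι K (S v) * shiftCoeff S (u - 1) x := by
  rcases lt_or_ge u 0 with hu | hu
  · simp [shiftCoeff_of_neg S hu, shiftCoeff_of_neg S (show u - 1 < 0 by omega)]
  obtain ⟨n, rfl⟩ := Int.eq_ofNat_of_zero_le hu
  cases n with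
  | zero =>
    rw [shiftCoeff_of_neg S (show (((0 : ℕ) : ℤ) - 1) < 0 by simp), shiftCoeff_natCast,
      shiftCoeff_natCast, oneSubHom_ι_mul]
    simp
  | succ n =>
    rw [show ((n + 1 : ℕ) : ℤ) - 1 = (n : ℕ) by push_cast; ring, shiftCoeff_natCast,
      shiftCoeff_natCast, shiftCoeff_natCast, oneSubHom_ι_mul]
    simp

theorem shiftCoeff_algebraMap (S : V →ₗ[K] V) (u : ℤ) (r : K) :
    shiftCoeff S u (algebraMap K _ r) = if u = 0 then algebraMap K _ r else 0 := by
  rcases lt_or_ge u 0 with hu | hu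
  · rw [shiftCoeff_of_neg S hu, if_neg (by omega)]
  obtain ⟨n, rfl⟩ := Int.eq_ofNat_of_zero_le hu
  rw [shiftCoeff_natCast, AlgHom.commutes, Polynomial.algebraMap_apply, Polynomial.coeff_C]
  simp

theorem shiftCoeff_zero (S : V →ₗ[K] V) (x : ExteriorAlgebra K V) : shiftCoeff S 0 x = x := by
  induction x using CliffordAlgebra.left_induction with
  | algebraMap r => exact (shiftCoeff_algebraMap S 0 r).trans (if_pos rfl)
  | add x y hx hy => rw [map_add, hx, hy]
  | ι_mul x v hx =>
    have := shiftCoeff_ι_mul S 0 v x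
    have h0 : shiftCoeff S (0 - 1) x = 0 := shiftCoeff_of_neg S (by norm_num) x
    rw [hx, h0, mul_zero, sub_zero] at this
    exact this

theorem shiftCoeff_eq_zero_of_lt (S : V →ₗ[K] V) {n : ℕ} {x : ExteriorAlgebra K V}
    (hx : x ∈ ⋀[K]^n V) {u : ℤ} (hu : (n : ℤ) < u) : shiftCoeff S u x = 0 := by
  refine exteriorPower_induction (C := fun n x => ∀ u : ℤ, (n : ℤ) < u → shiftCoeff S u x = 0)
    ?_ ?_ ?_ hx u hu
  · intro r u hu
    rw [shiftCoeff_algebraMap, if_neg (by push_cast at hu; omega)]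
  · intro n x y _ _ hx hy u hu
    rw [map_add, hx u hu, hy u hu, add_zero]
  · intro n v x _ hx u hu
    push_cast at hu
    rw [shiftCoeff_ι_mul, hx u (by omega), hx (u - 1) (by omega), mul_zero, mul_zero, sub_zero]

theorem contract_shiftCoeff (S : V →ₗ[K] V) (f : Module.Dual K V) (u : ℤ)
    (x : ExteriorAlgebra K V) :
    contract f (shiftCoeff S u x) =
      shiftCoeff S u (contract f x) - shiftCoeff S (u - 1) (contract (f ∘ₗ S) x) := by
  induction x using CliffordAlgebra.left_induction generalizing u with
  | algebraMap r =>
    have h : ∀ g : Module.Dual K V, contract g (algebraMap K (ExteriorAlgebra K V) r) = 0 :=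
      fun g => contract_algebraMap g r
    change contract f (shiftCoeff S u (algebraMap K (ExteriorAlgebra K V) r)) =
      shiftCoeff S u (contract f (algebraMap K (ExteriorAlgebra K V) r)) -
        shiftCoeff S (u - 1) (contract (f ∘ₗ S) (algebraMap K (ExteriorAlgebra K V) r))
    rw [shiftCoeff_algebraMap, h, h, map_zero, map_zero, sub_zero]
    split_ifs
    · exact h f
    · exact map_zero _
  | add x y hx hy => rw [map_add, map_add, hx, hy]; simp only [map_add]; abel
  | ι_mul x v hx =>
    change contract f (shiftCoeff S u (ExteriorAlgebra.ι K v * x)) =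
      shiftCoeff S u (contract f (ExteriorAlgebra.ι K v * x)) -
        shiftCoeff S (u - 1) (contract (f ∘ₗ S) (ExteriorAlgebra.ι K v * x))
    simp only [shiftCoeff_ι_mul, map_sub, contract_ι_mul, map_smul, hx, mul_sub,
      LinearMap.comp_apply]
    abel

end Operators

/-! ### Frames indexed by a window of integers -/

/-- Vectors `a_j` and linear forms `a_j^*`, for `-p ≤ j ≤ p`, that are dual to each other. Both
families are indexed by all integers and vanish outside the window. -/
structure WindowFrame (K V : Type*) [Field K] [AddCommGroup V] [Module K V] (p : ℕ) where
  /-- The vectors `a_j`. -/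
  vec : ℤ → V
  /-- The linear forms `a_j^*`. -/
  dual : ℤ → Module.Dual K V
  vec_eq_zero : ∀ j : ℤ, ¬ (-(p : ℤ) ≤ j ∧ j ≤ p) → vec j = 0
  dual_eq_zero : ∀ j : ℤ, ¬ (-(p : ℤ) ≤ j ∧ j ≤ p) → dual j = 0
  dual_vec : ∀ i j : ℤ, -(p : ℤ) ≤ j → j ≤ p → dual i (vec j) = if i = j then 1 else 0

namespace WindowFrame

variable {K V : Type*} [Field K] [AddCommGroup V] [Module K V] {p : ℕ} (F : WindowFrame K V p)

/-- The endomorphism of degree `n` with respect to the index: it sends `a_j` to `a_{j+n}`. -/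
noncomputable def translate (n : ℤ) : V →ₗ[K] V :=
  ∑ j ∈ Finset.Icc (-(p : ℤ)) p, (F.dual j).smulRight (F.vec (j + n))

theorem translate_apply (n : ℤ) (v : V) :
    F.translate n v = ∑ j ∈ Finset.Icc (-(p : ℤ)) p, F.dual j v • F.vec (j + n) := by
  simp [translate]

theorem translate_vec {n j : ℤ} (hn : 0 ≤ n) (hj : -(p : ℤ) ≤ j) :
    F.translate n (F.vec j) = F.vec (j + n) := by
  rcases le_or_gt j p with h | h
  · rw [translate_apply, Finset.sum_eq_single_of_mem j (Finset.mem_Icc.2 ⟨hj, h⟩),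
      F.dual_vec _ _ hj h, if_pos rfl, one_smul]
    intro i _ hi
    rw [F.dual_vec _ _ hj h, if_neg hi, zero_smul]
  · rw [F.vec_eq_zero j (by omega), F.vec_eq_zero (j + n) (by omega), map_zero]

theorem translate_translate_one {n : ℤ} (hn : 0 ≤ n) (v : V) :
    F.translate n (F.translate 1 v) = F.translate (n + 1) v := by
  rw [F.translate_apply 1, F.translate_apply (n + 1), map_sum]
  refine Finset.sum_congr rfl fun j hj => ?_
  rw [map_smul, F.translate_vec hn (by have := (Finset.mem_Icc.1 hj).1; omega)]
  congr 2
  ring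

theorem dual_comp_translate_one {j : ℤ} (hj : j ≤ p) :
    F.dual j ∘ₗ F.translate 1 = F.dual (j - 1) := by
  ext v
  rw [LinearMap.comp_apply, translate_apply, map_sum]
  have h : ∀ i ∈ Finset.Icc (-(p : ℤ)) p, F.dual j (F.dual i v • F.vec (i + 1)) =
      if i = j - 1 then F.dual (j - 1) v else 0 := by
    intro i hi
    rw [Finset.mem_Icc] at hi
    rw [map_smul, smul_eq_mul]
    rcases le_or_gt (i + 1) p with h | h
    · rw [F.dual_vec _ _ (by omega) h]
      by_cases hij : i = j - 1
      · rw [if_pos (by omega), if_pos hij, mul_one, hij]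
      · rw [if_neg (by omega), if_neg hij, mul_zero]
    · rw [F.vec_eq_zero _ (by omega), map_zero, mul_zero, if_neg (by omega)]
  rw [Finset.sum_congr rfl h, Finset.sum_ite_eq']
  split_ifs with h'
  · rfl
  · rw [Finset.mem_Icc] at h'
    rw [F.dual_eq_zero _ h', LinearMap.zero_apply]

/-- Multiplication by `a_j` from the left. -/
noncomputable def wedge (j : ℤ) : ExteriorAlgebra K V →ₗ[K] ExteriorAlgebra K V :=
  LinearMap.mulLeft K (ExteriorAlgebra.ι K (F.vec j))

/-- Contraction with `a_j^*`. -/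
noncomputable def cut (j : ℤ) : ExteriorAlgebra K V →ₗ[K] ExteriorAlgebra K V :=
  contract (F.dual j)

/-- The coefficients of `Λ(1 - y S)`, where `S` is the nilpotent translation `a_j ↦ a_{j+1}`. -/
noncomputable def coeff (u : ℤ) : ExteriorAlgebra K V →ₗ[K] ExteriorAlgebra K V :=
  shiftCoeff (F.translate 1) u

theorem wedge_apply (j : ℤ) (x : ExteriorAlgebra K V) :
    F.wedge j x = ExteriorAlgebra.ι K (F.vec j) * x := rfl

theorem wedge_eq_zero {j : ℤ} (hj : ¬ (-(p : ℤ) ≤ j ∧ j ≤ p)) (x : ExteriorAlgebra K V) :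
    F.wedge j x = 0 := by
  rw [wedge_apply, F.vec_eq_zero j hj, map_zero, zero_mul]

theorem cut_comm (i j : ℤ) (x : ExteriorAlgebra K V) : F.cut i (F.cut j x) = -F.cut j (F.cut i x) :=
  contract_comm _ _ x

theorem cut_self (j : ℤ) (x : ExteriorAlgebra K V) : F.cut j (F.cut j x) = 0 :=
  contract_self _ x

theorem cut_wedge {j : ℤ} (hj : -(p : ℤ) ≤ j ∧ j ≤ p) (i : ℤ) (x : ExteriorAlgebra K V) :
    F.cut i (F.wedge j x) = (if i = j then x else 0) - F.wedge j (F.cut i x) := by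
  rw [cut, wedge_apply, contract_ι_mul, F.dual_vec i j hj.1 hj.2, wedge_apply, ite_smul, one_smul,
    zero_smul]

theorem cut_wedge_of_mem {i : ℤ} (hi : -(p : ℤ) ≤ i ∧ i ≤ p) (j : ℤ) (x : ExteriorAlgebra K V) :
    F.cut i (F.wedge j x) = (if i = j then x else 0) - F.wedge j (F.cut i x) := by
  by_cases hj : -(p : ℤ) ≤ j ∧ j ≤ p
  · exact F.cut_wedge hj i x
  · rw [F.wedge_eq_zero hj, F.wedge_eq_zero hj, map_zero, if_neg, sub_zero]
    rintro rfl
    exact hj hi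

theorem wedge_mem (j : ℤ) {n : ℕ} {x : ExteriorAlgebra K V} (hx : x ∈ ⋀[K]^n V) :
    F.wedge j x ∈ ⋀[K]^(n + 1) V :=
  ι_mul_mem_exteriorPower _ hx

theorem coeff_of_neg {u : ℤ} (hu : u < 0) (x : ExteriorAlgebra K V) : F.coeff u x = 0 :=
  shiftCoeff_of_neg _ hu x

theorem coeff_zero (x : ExteriorAlgebra K V) : F.coeff 0 x = x :=
  shiftCoeff_zero _ x

theorem coeff_eq_zero_of_lt {n : ℕ} {x : ExteriorAlgebra K V} (hx : x ∈ ⋀[K]^n V) {u : ℤ}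
    (hu : (n : ℤ) < u) : F.coeff u x = 0 :=
  shiftCoeff_eq_zero_of_lt _ hx hu

theorem coeff_cut_eq_zero {n : ℕ} {x : ExteriorAlgebra K V} (hx : x ∈ ⋀[K]^n V) (j : ℤ) {u : ℤ}
    (hu : (n : ℤ) ≤ u) : F.coeff u (F.cut j x) = 0 := by
  cases n with
  | zero => rw [cut, contract_eq_zero_of_mem_zero _ hx, map_zero]
  | succ n =>
    exact F.coeff_eq_zero_of_lt (contract_mem_exteriorPower _ hx) (by push_cast at hu; omega)

theorem coeff_wedge {j : ℤ} (hj : -(p : ℤ) ≤ j) (u : ℤ) (x : ExteriorAlgebra K V) :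
    F.coeff u (F.wedge j x) = F.wedge j (F.coeff u x) - F.wedge (j + 1) (F.coeff (u - 1) x) := by
  rw [coeff, wedge_apply, shiftCoeff_ι_mul, F.translate_vec (by norm_num) hj]
  rfl

theorem cut_coeff {j : ℤ} (hj : j ≤ p) (u : ℤ) (x : ExteriorAlgebra K V) :
    F.cut j (F.coeff u x) = F.coeff u (F.cut j x) - F.coeff (u - 1) (F.cut (j - 1) x) := by
  rw [cut, coeff, contract_shiftCoeff, F.dual_comp_translate_one hj]
  rfl

/-! ### Telescoping identities -/

theorem sum_coeff_wedge {b c₀ c₁ : ℤ} (h₀ : -(p : ℤ) ≤ c₀ - b) (h₁ : c₀ ≤ c₁ + 1) (n : ℤ)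
    (x : ExteriorAlgebra K V) :
    ∑ c ∈ Finset.Icc c₀ c₁, F.coeff (n - c) (F.wedge (c - b) x) =
      F.wedge (c₀ - b) (F.coeff (n - c₀) x) -
        F.wedge (c₁ + 1 - b) (F.coeff (n - (c₁ + 1)) x) := by
  rw [← sum_Icc_int_telescope (fun c => F.wedge (c - b) (F.coeff (n - c) x)) h₁]
  refine Finset.sum_congr rfl fun c hc => ?_
  rw [Finset.mem_Icc] at hc
  rw [F.coeff_wedge (by omega), show c - b + 1 = c + 1 - b by ring,
    show n - c - 1 = n - (c + 1) by ring]

/-- A window of `p + 1` consecutive columns of a Toeplitz matrix with entries `a_{c-b}` is inverted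
by the operators `Φ_u` and the contractions. -/
theorem sum_coeff_cut_wedge {n : ℕ} (hn : n ≤ p) {x : ExteriorAlgebra K V} (hx : x ∈ ⋀[K]^n V)
    {b c₀ j : ℤ} (h₀ : -(p : ℤ) ≤ c₀ - b) (hj : -(p : ℤ) ≤ j ∧ j ≤ p) :
    ∑ c ∈ Finset.Icc c₀ (c₀ + p), F.coeff (c₀ + p - c) (F.cut j (F.wedge (c - b) x)) =
      F.coeff (c₀ + p - j - b) x := by
  have h : ∀ c ∈ Finset.Icc c₀ (c₀ + p), F.coeff (c₀ + p - c) (F.cut j (F.wedge (c - b) x)) =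
      (if c = b + j then F.coeff (c₀ + p - j - b) x else 0) -
        F.coeff (c₀ + p - c) (F.wedge (c - b) (F.cut j x)) := by
    intro c _
    rw [F.cut_wedge_of_mem hj, map_sub]
    congr 1
    by_cases hc : c = b + j
    · rw [if_pos (by omega), if_pos hc, show c₀ + p - c = c₀ + p - j - b by omega]
    · rw [if_neg (by omega), if_neg hc, map_zero]
  rw [Finset.sum_congr rfl h, Finset.sum_sub_distrib, Finset.sum_ite_eq',
    F.sum_coeff_wedge h₀ (by omega), F.coeff_cut_eq_zero hx j (by omega),
    F.coeff_of_neg (u := c₀ + p - (c₀ + p + 1)) (by omega), map_zero, map_zero, sub_zero, sub_zero]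
  split_ifs with hb
  · rfl
  · rw [Finset.mem_Icc, not_and_or] at hb
    rcases hb with hb | hb
    · rw [F.coeff_eq_zero_of_lt hx (by omega)]
    · rw [F.coeff_of_neg (by omega)]

/-- The system `∑ Φ_{n-b} x_b = 0` is unitriangular. -/
theorem eq_zero_of_sum_coeff_eq_zero {B : ℤ} {x : ℤ → ExteriorAlgebra K V}
    (h : ∀ n ∈ Finset.Icc 0 B, ∑ b ∈ Finset.Icc 0 B, F.coeff (n - b) (x b) = 0) :
    ∀ b ∈ Finset.Icc 0 B, x b = 0 := by
  have key : ∀ k : ℕ, ∀ b ∈ Finset.Icc 0 B, b < k → x b = 0 := by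
    intro k
    induction k with
    | zero => intro b hb hk; rw [Finset.mem_Icc] at hb; push_cast at hk; omega
    | succ k ih =>
      intro b hb hk
      rw [← h b hb, Finset.sum_eq_single_of_mem b hb, sub_self, F.coeff_zero]
      intro i hi hib
      rcases lt_or_gt_of_ne hib with h' | h'
      · rw [ih i hi (by push_cast at hk; omega), map_zero]
      · exact F.coeff_of_neg (by omega) _
  intro b hb
  exact key (b + 1).toNat b hb (by rw [Finset.mem_Icc] at hb; omega)

/-- The flattening of the Toeplitz tensor `∑ a_{c-b} ⊗ b_b ⊗ c_c`, `0 ≤ b, c ≤ p`, is injective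
on `Λ^n ⊗ B*` for `n ≤ p`. -/
theorem toeplitz_injective {n : ℕ} (hn : n ≤ p) {x : ℤ → ExteriorAlgebra K V}
    (hx : ∀ b, x b ∈ ⋀[K]^n V)
    (h : ∀ c ∈ Finset.Icc (0 : ℤ) p, ∑ b ∈ Finset.Icc (0 : ℤ) p, F.wedge (c - b) (x b) = 0) :
    ∀ b ∈ Finset.Icc (0 : ℤ) p, x b = 0 := by
  refine F.eq_zero_of_sum_coeff_eq_zero fun q hq => ?_
  rw [Finset.mem_Icc] at hq
  have h1 : ∑ c ∈ Finset.Icc (0 : ℤ) (0 + p), F.coeff (0 + p - c) (F.cut (p - q)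
      (∑ b ∈ Finset.Icc (0 : ℤ) p, F.wedge (c - b) (x b))) = 0 := by
    refine Finset.sum_eq_zero fun c hc => ?_
    rw [zero_add] at hc
    rw [h c hc, map_zero, map_zero]
  simp only [map_sum] at h1
  rw [Finset.sum_comm] at h1
  rw [← h1]
  refine Finset.sum_congr rfl fun b hb => ?_
  rw [Finset.mem_Icc] at hb
  rw [F.sum_coeff_cut_wedge hn (hx b) (by omega) (by omega)]
  congr 2
  ring

/-! ### Newton's identity -/

/-- The derivation of the exterior algebra that extends the translation `a_j ↦ a_{j+n}`. -/
noncomputable def power (n : ℤ) : ExteriorAlgebra K V →ₗ[K] ExteriorAlgebra K V :=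
  ∑ i ∈ Finset.Icc (-(p : ℤ)) p, F.wedge (i + n) ∘ₗ F.cut i

theorem power_apply (n : ℤ) (x : ExteriorAlgebra K V) :
    F.power n x = ∑ i ∈ Finset.Icc (-(p : ℤ)) p, F.wedge (i + n) (F.cut i x) := by
  simp [power]

theorem power_ι_mul (n : ℤ) (v : V) (x : ExteriorAlgebra K V) :
    F.power n (ExteriorAlgebra.ι K v * x) =
      ExteriorAlgebra.ι K v * F.power n x + ExteriorAlgebra.ι K (F.translate n v) * x := by
  rw [power_apply, power_apply, translate_apply, map_sum, Finset.mul_sum, Finset.sum_mul,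
    ← Finset.sum_add_distrib]
  refine Finset.sum_congr rfl fun i _ => ?_
  rw [cut, contract_ι_mul, map_sub, map_smul, wedge_apply, wedge_apply, wedge_apply,
    ι_mul_ι_mul_comm, map_smul, smul_mul_assoc]
  abel

theorem power_algebraMap (n : ℤ) (r : K) :
    F.power n (algebraMap K (ExteriorAlgebra K V) r) = 0 := by
  rw [power_apply]
  refine Finset.sum_eq_zero fun i _ => ?_
  rw [cut, contract_algebraMap, map_zero]

/-- Newton's identity between the elementary symmetric functions `Φ_u` and the power sums of the
nilpotent endomorphism `a_j ↦ a_{j+1}`. -/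
theorem smul_coeff_eq {M u : ℤ} (hM : 0 ≤ M) (hu : u ≤ M) (x : ExteriorAlgebra K V) :
    (u : K) • F.coeff u x = -∑ j ∈ Finset.Icc 1 M, F.power j (F.coeff (u - j) x) := by
  induction x using CliffordAlgebra.left_induction generalizing u with
  | algebraMap r =>
    change (u : K) • shiftCoeff _ u (algebraMap K (ExteriorAlgebra K V) r) =
      -∑ j ∈ Finset.Icc 1 M, F.power j (shiftCoeff _ (u - j) (algebraMap K (ExteriorAlgebra K V) r))
    rw [Finset.sum_eq_zero, shiftCoeff_algebraMap]
    · split_ifs with h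
      · rw [h, Int.cast_zero, zero_smul, neg_zero]
      · rw [smul_zero, neg_zero]
    · intro j _
      rw [shiftCoeff_algebraMap]
      split_ifs
      · exact F.power_algebraMap j r
      · exact map_zero _
  | add x y hx hy =>
    simp only [map_add, smul_add, Finset.sum_add_distrib, neg_add, hx hu, hy hu]
  | ι_mul x v hx =>
    change (u : K) • shiftCoeff _ u (ExteriorAlgebra.ι K v * x) =
      -∑ j ∈ Finset.Icc 1 M, F.power j (shiftCoeff _ (u - j) (ExteriorAlgebra.ι K v * x))
    have hterm : ∀ j ∈ Finset.Icc 1 M,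
        F.power j (shiftCoeff (F.translate 1) (u - j) (ExteriorAlgebra.ι K v * x)) =
        ExteriorAlgebra.ι K v * F.power j (F.coeff (u - j) x) -
          ExteriorAlgebra.ι K (F.translate 1 v) * F.power j (F.coeff (u - 1 - j) x) +
        (ExteriorAlgebra.ι K (F.translate j v) * F.coeff (u - j) x -
          ExteriorAlgebra.ι K (F.translate (j + 1) v) * F.coeff (u - (j + 1)) x) := by
      intro j hj
      rw [Finset.mem_Icc] at hj
      rw [shiftCoeff_ι_mul, map_sub, power_ι_mul, power_ι_mul,
        F.translate_translate_one (by omega), show u - j - 1 = u - 1 - j by ring,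
        show u - (j + 1) = u - 1 - j by ring]
      simp only [coeff]
      abel
    rw [Finset.sum_congr rfl hterm, Finset.sum_add_distrib, Finset.sum_sub_distrib,
      sum_Icc_int_telescope (fun j => ExteriorAlgebra.ι K (F.translate j v) * F.coeff (u - j) x)
        (by omega), F.coeff_of_neg (u := u - (M + 1)) (by omega), mul_zero, sub_zero,
      ← Finset.mul_sum, ← Finset.mul_sum, ← neg_eq_iff_eq_neg.2 (hx hu),
      ← neg_eq_iff_eq_neg.2 (hx (show u - 1 ≤ M by omega)), shiftCoeff_ι_mul]
    simp only [coeff, mul_neg, mul_smul_comm, Int.cast_sub, Int.cast_one, sub_smul, one_smul,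
      smul_sub, mul_sub]
    abel

theorem cut_power {n j : ℤ} (hj : -(p : ℤ) ≤ j ∧ j ≤ p) (hn : -(p : ℤ) ≤ j - n ∧ j - n ≤ p)
    (x : ExteriorAlgebra K V) :
    F.cut j (F.power n x) = F.power n (F.cut j x) + F.cut (j - n) x := by
  rw [power_apply, power_apply, map_sum]
  have h : ∀ i ∈ Finset.Icc (-(p : ℤ)) p, F.cut j (F.wedge (i + n) (F.cut i x)) =
      F.wedge (i + n) (F.cut i (F.cut j x)) + if i = j - n then F.cut (j - n) x else 0 := by
    intro i _
    rw [F.cut_wedge_of_mem hj, F.cut_comm j i, map_neg, sub_neg_eq_add, add_comm]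
    congr 1
    by_cases hi : i = j - n
    · rw [if_pos (by omega), if_pos hi, hi]
    · rw [if_neg (by omega), if_neg hi]
  rw [Finset.sum_congr rfl h, Finset.sum_add_distrib, Finset.sum_ite_eq',
    if_pos (Finset.mem_Icc.2 hn)]

end WindowFrame

namespace WindowFrame

variable {K V : Type*} [Field K] [AddCommGroup V] [Module K V] {p : ℕ} (F : WindowFrame K V p)

/-! ### Hard Lefschetz for the exterior algebra of a symplectic space -/

/-- The lowering operator `∑ a_{-q}^* a_q^*`, `1 ≤ q ≤ p`. -/
noncomputable def lower : ExteriorAlgebra K V →ₗ[K] ExteriorAlgebra K V :=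
  ∑ q ∈ Finset.Icc (1 : ℤ) p, F.cut (-q) ∘ₗ F.cut q

/-- The raising operator `∑ a_q a_{-q}`, `1 ≤ q ≤ p`. -/
noncomputable def raise : ExteriorAlgebra K V →ₗ[K] ExteriorAlgebra K V :=
  ∑ q ∈ Finset.Icc (1 : ℤ) p, F.wedge q ∘ₗ F.wedge (-q)

theorem lower_apply (x : ExteriorAlgebra K V) :
    F.lower x = ∑ q ∈ Finset.Icc (1 : ℤ) p, F.cut (-q) (F.cut q x) := by
  simp [lower]

theorem raise_apply (x : ExteriorAlgebra K V) :
    F.raise x = ∑ q ∈ Finset.Icc (1 : ℤ) p, F.wedge q (F.wedge (-q) x) := by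
  simp [raise]

theorem raise_mem {n : ℕ} {x : ExteriorAlgebra K V} (hx : x ∈ ⋀[K]^n V) :
    F.raise x ∈ ⋀[K]^(n + 2) V := by
  rw [raise_apply]
  exact Submodule.sum_mem _ fun q _ => F.wedge_mem _ (F.wedge_mem _ hx)

theorem cut_zero_raise (x : ExteriorAlgebra K V) : F.cut 0 (F.raise x) = F.raise (F.cut 0 x) := by
  rw [raise_apply, raise_apply, map_sum]
  refine Finset.sum_congr rfl fun q hq => ?_
  rw [Finset.mem_Icc] at hq
  rw [F.cut_wedge (by omega), if_neg (by omega), F.cut_wedge (by omega), if_neg (by omega),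
    zero_sub, zero_sub, map_neg, neg_neg]

theorem cut_zero_lower (x : ExteriorAlgebra K V) : F.cut 0 (F.lower x) = F.lower (F.cut 0 x) := by
  rw [lower_apply, lower_apply, map_sum]
  refine Finset.sum_congr rfl fun q _ => ?_
  rw [F.cut_comm 0, F.cut_comm 0 q, map_neg, neg_neg]

theorem power_zero_eq_smul (hF : ∀ v, F.translate 0 v = v) {n : ℕ} {x : ExteriorAlgebra K V}
    (hx : x ∈ ⋀[K]^n V) : F.power 0 x = (n : K) • x := by
  refine exteriorPower_induction (C := fun n x => F.power 0 x = (n : K) • x) ?_ ?_ ?_ hx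
  · intro r
    rw [F.power_algebraMap, Nat.cast_zero, zero_smul]
  · intro n x y _ _ hx hy
    rw [map_add, hx, hy, smul_add]
  · intro n v x _ hx
    rw [power_ι_mul, hF, hx, mul_smul_comm, Nat.cast_add, Nat.cast_one, add_smul, one_smul]

theorem power_zero_eq (x : ExteriorAlgebra K V) :
    F.power 0 x = F.wedge 0 (F.cut 0 x) + ∑ q ∈ Finset.Icc (1 : ℤ) p,
      (F.wedge q (F.cut q x) + F.wedge (-q) (F.cut (-q) x)) := by
  have h : Finset.Icc (-(p : ℤ)) p =
      insert 0 (Finset.Icc (1 : ℤ) p ∪ (Finset.Icc (1 : ℤ) p).image Neg.neg) := by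
    ext j
    simp only [Finset.mem_Icc, Finset.mem_insert, Finset.mem_union, Finset.mem_image]
    constructor
    · intro hj
      rcases lt_trichotomy j 0 with h | h | h
      · exact Or.inr (Or.inr ⟨-j, by omega, by omega⟩)
      · exact Or.inl h
      · exact Or.inr (Or.inl (by omega))
    · rintro (h | h | ⟨i, h, rfl⟩) <;> omega
  rw [power_apply, h, Finset.sum_insert, Finset.sum_union, Finset.sum_image (by simp),
    Finset.sum_add_distrib]
  · simp only [add_zero]
  · rw [Finset.disjoint_left]
    intro j hj hj'
    simp only [Finset.mem_Icc, Finset.mem_image] at hj hj'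
    obtain ⟨i, hi, rfl⟩ := hj'
    omega
  · simp only [Finset.mem_Icc, Finset.mem_union, Finset.mem_image]
    rintro (h | ⟨i, hi, h⟩) <;> omega

/-- The commutator of the raising and lowering operators. -/
theorem lower_raise (x : ExteriorAlgebra K V) :
    F.lower (F.raise x) = F.raise (F.lower x) + (p : K) • x -
      ∑ q ∈ Finset.Icc (1 : ℤ) p, (F.wedge q (F.cut q x) + F.wedge (-q) (F.cut (-q) x)) := by
  have h : ∀ q ∈ Finset.Icc (1 : ℤ) p, ∀ r ∈ Finset.Icc (1 : ℤ) p,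
      F.cut (-q) (F.cut q (F.wedge r (F.wedge (-r) x))) =
        F.wedge r (F.wedge (-r) (F.cut (-q) (F.cut q x))) +
        if q = r then x - (F.wedge q (F.cut q x) + F.wedge (-q) (F.cut (-q) x)) else 0 := by
    intro q hq r hr
    rw [Finset.mem_Icc] at hq hr
    rw [F.cut_wedge (by omega) q, F.cut_wedge (by omega) q, if_neg (show q ≠ -r by omega), zero_sub,
      map_neg, sub_neg_eq_add, map_add, F.cut_wedge (by omega) (-q), if_neg (show -q ≠ r by omega),
      zero_sub, F.cut_wedge (by omega) (-q)]
    by_cases hqr : q = r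
    · subst hqr
      rw [if_pos rfl, if_pos rfl, if_pos rfl, F.cut_wedge (by omega) (-q), if_pos rfl]
      rw [map_sub]
      abel
    · rw [if_neg hqr, if_neg (by omega), if_neg hqr, map_zero, zero_sub, map_neg]
      abel
  rw [raise_apply, map_sum, raise_apply, lower_apply]
  simp only [lower_apply, map_sum]
  rw [Finset.sum_comm, Finset.sum_congr rfl fun q hq => Finset.sum_congr rfl (h q hq)]
  simp only [Finset.sum_add_distrib, Finset.sum_ite_eq]
  rw [add_sub_assoc, Finset.sum_comm]
  congr 1
  rw [Finset.sum_congr rfl fun q hq => if_pos hq, Finset.sum_sub_distrib, Finset.sum_const,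
    Int.card_Icc, Finset.sum_add_distrib, add_sub_cancel_right, Int.toNat_natCast,
    Nat.cast_smul_eq_nsmul]

/-- The lowering operator has no kernel in degree `p + 1` on the exterior algebra of the span of the
`a_j`, `j ≠ 0`, where the middle degree is `p`: for `z` in that kernel, the powers of the raising
operator satisfy `lower (raise^(k+1) z) = -(k+1)² raise^k z`, and they vanish for large `k`. -/
theorem eq_zero_of_lower_eq_zero [CharZero K] [FiniteDimensional K V]
    (hF : ∀ v, F.translate 0 v = v) {z : ExteriorAlgebra K V} (hz : z ∈ ⋀[K]^(p + 1) V)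
    (h₀ : F.cut 0 z = 0) (hlow : F.lower z = 0) : z = 0 := by
  have hmem : ∀ k : ℕ,
      (F.raise ^ k) z ∈ ⋀[K]^(p + 1 + 2 * k) V ∧ F.cut 0 ((F.raise ^ k) z) = 0 := by
    intro k
    induction k with
    | zero => simpa using ⟨hz, h₀⟩
    | succ k ih =>
      rw [pow_succ', Module.End.mul_apply]
      exact ⟨F.raise_mem ih.1, by rw [cut_zero_raise, ih.2, map_zero]⟩
  have hstep : ∀ k : ℕ,
      F.lower ((F.raise ^ (k + 1)) z) = (-((k : K) + 1) ^ 2) • (F.raise ^ k) z := by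
    intro k
    have hsum : ∑ q ∈ Finset.Icc (1 : ℤ) p, (F.wedge q (F.cut q ((F.raise ^ k) z)) +
        F.wedge (-q) (F.cut (-q) ((F.raise ^ k) z))) =
        ((p + 1 + 2 * k : ℕ) : K) • (F.raise ^ k) z := by
      rw [← F.power_zero_eq_smul hF (hmem k).1, power_zero_eq, (hmem k).2, map_zero, zero_add]
    have hraise : F.raise (F.lower ((F.raise ^ k) z)) = (-(k : K) ^ 2) • (F.raise ^ k) z := by
      induction k with
      | zero => simp [hlow]
      | succ k ih =>
        have hsum' : ∑ q ∈ Finset.Icc (1 : ℤ) p, (F.wedge q (F.cut q ((F.raise ^ k) z)) +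
            F.wedge (-q) (F.cut (-q) ((F.raise ^ k) z))) =
            ((p + 1 + 2 * k : ℕ) : K) • (F.raise ^ k) z := by
          rw [← F.power_zero_eq_smul hF (hmem k).1, power_zero_eq, (hmem k).2, map_zero, zero_add]
        rw [pow_succ', Module.End.mul_apply, lower_raise, hsum', ih hsum', ← add_smul, ← sub_smul,
          map_smul]
        congr 1
        push_cast
        ring
    rw [pow_succ', Module.End.mul_apply, lower_raise, hsum, hraise, ← add_smul, ← sub_smul]
    congr 1
    push_cast
    ring
  have hdesc : ∀ k : ℕ, (F.raise ^ k) z = 0 → z = 0 := by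
    intro k
    induction k with
    | zero => exact fun h => by simpa using h
    | succ k ih =>
      intro h
      refine ih ?_
      have h' := hstep k
      rw [h, map_zero, eq_comm, smul_eq_zero] at h'
      refine h'.resolve_left (neg_ne_zero.2 (pow_ne_zero _ ?_))
      exact Nat.cast_add_one_ne_zero k
  refine hdesc (Module.finrank K V) ?_
  have hbot : Subsingleton (⋀[K]^(p + 1 + 2 * Module.finrank K V) V) := by
    rw [← Module.finrank_zero_iff (R := K), exteriorPower.finrank_eq, Nat.choose_eq_zero_of_lt]
    omega
  exact congrArg Subtype.val (Subsingleton.elim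
    (⟨_, (hmem (Module.finrank K V)).1⟩ : ⋀[K]^(p + 1 + 2 * Module.finrank K V) V) 0)

end WindowFrame

namespace WindowFrame

variable {K V : Type*} [Field K] [AddCommGroup V] [Module K V] {p : ℕ} (F : WindowFrame K V p)

/-! ### Two overlapping Toeplitz windows -/

/-- The operator `∑_q a_0^* a_q^* ∑_c Φ_{p+q-c}` kills the lower end of a telescoping sum that
starts at the first column of the window containing `b`. -/
theorem sum_cut_cut_wedge_coeff_eq_zero {x : ExteriorAlgebra K V} (hx : x ∈ ⋀[K]^p V) {b c₀ : ℤ}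
    (hb : 0 ≤ b ∧ b ≤ 2 * p) (hc : c₀ = if b ≤ p then 0 else (p : ℤ)) :
    ∑ q ∈ Finset.Icc (1 : ℤ) p,
      F.cut 0 (F.cut q (F.wedge (c₀ - b) (F.coeff (p + q - c₀) x))) = 0 := by
  by_cases h : b ≤ p
  · rw [if_pos h] at hc
    subst hc
    refine Finset.sum_eq_zero fun q hq => ?_
    rw [Finset.mem_Icc] at hq
    rw [F.coeff_eq_zero_of_lt hx (by omega), map_zero, map_zero, map_zero]
  · rw [if_neg h] at hc
    subst hc
    have hterm : ∀ q ∈ Finset.Icc (1 : ℤ) p,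
        F.cut 0 (F.cut q (F.wedge (p - b) (F.coeff (p + q - p) x))) =
          -F.wedge (p - b) (F.cut 0 (F.coeff (q - 1) (F.cut (q - 1) x) -
            F.coeff (q + 1 - 1) (F.cut (q + 1 - 1) x))) := by
      intro q hq
      rw [Finset.mem_Icc] at hq
      rw [F.cut_wedge (by omega), if_neg (by omega), zero_sub, map_neg, F.cut_wedge (by omega),
        if_neg (by omega), zero_sub, neg_neg, add_sub_cancel_left, F.cut_coeff (by omega),
        add_sub_cancel_right, ← map_neg (F.wedge _), ← map_neg (F.cut 0), neg_sub]
    rw [Finset.sum_congr rfl hterm, Finset.sum_neg_distrib, ← map_sum, ← map_sum,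
      sum_Icc_int_telescope (fun q => F.coeff (q - 1) (F.cut (q - 1) x)) (by omega), sub_self,
      F.coeff_zero, F.coeff_cut_eq_zero hx _ (by omega), sub_zero, cut_self, map_zero, neg_zero]

/-- The weighted family `W_n = ∑ b Φ_{n-b} ξ_b` is determined by `κ_n = ∑ Φ_{n-b} ξ_b`, by Newton's
identity. -/
theorem sum_smul_coeff_eq {M n : ℤ} (hn : n ≤ M) (hM : 0 ≤ M) (x : ℤ → ExteriorAlgebra K V) :
    ∑ b ∈ Finset.Icc 0 M, (b : K) • F.coeff (n - b) (x b) =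
      (n : K) • ∑ b ∈ Finset.Icc 0 M, F.coeff (n - b) (x b) +
        ∑ j ∈ Finset.Icc 1 M, F.power j (∑ b ∈ Finset.Icc 0 M, F.coeff (n - j - b) (x b)) := by
  simp only [map_sum, Finset.smul_sum]
  rw [Finset.sum_comm (s := Finset.Icc 1 M), ← Finset.sum_add_distrib]
  refine Finset.sum_congr rfl fun b hb => ?_
  rw [Finset.mem_Icc] at hb
  have h := F.smul_coeff_eq hM (show n - b ≤ M by omega) (x b)
  rw [Int.cast_sub, sub_smul] at h
  rw [eq_neg_iff_add_eq_zero] at h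
  rw [← sub_eq_zero, ← neg_eq_zero, ← h]
  simp only [show ∀ j : ℤ, n - j - b = n - b - j from fun j => by ring]
  abel

/-- The operators `∑_r N_{q+r} a_r^*` contribute to `∑_q a_q^*` only through the commutators
`[a_q^*, N_{q+r}] = a_{-r}^*`, because `N_{q+r}` is symmetric in `q` and `r` and `a_q^* a_r^*` is
antisymmetric. -/
theorem sum_cut_sum_power [CharZero K] (z : ExteriorAlgebra K V) :
    ∑ q ∈ Finset.Icc (1 : ℤ) p, F.cut q
      (∑ r ∈ Finset.Icc (1 : ℤ) p, F.power (q + r) (F.cut r z)) = (p : K) • F.lower z := by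
  have h : ∀ q ∈ Finset.Icc (1 : ℤ) p, ∀ r ∈ Finset.Icc (1 : ℤ) p,
      F.cut q (F.power (q + r) (F.cut r z)) =
        F.power (q + r) (F.cut q (F.cut r z)) + F.cut (-r) (F.cut r z) := by
    intro q hq r hr
    rw [Finset.mem_Icc] at hq hr
    rw [F.cut_power (by omega) (by omega)]
    congr 3
    ring
  have hanti : ∑ q ∈ Finset.Icc (1 : ℤ) p, ∑ r ∈ Finset.Icc (1 : ℤ) p,
      F.power (q + r) (F.cut q (F.cut r z)) = 0 := by
    refine (smul_eq_zero.1 (?_ : (2 : K) • (_ : ExteriorAlgebra K V) = 0)).resolve_left two_ne_zero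
    rw [two_smul]
    nth_rw 1 [Finset.sum_comm]
    rw [← Finset.sum_add_distrib]
    refine Finset.sum_eq_zero fun q _ => ?_
    rw [← Finset.sum_add_distrib]
    refine Finset.sum_eq_zero fun r _ => ?_
    rw [F.cut_comm r q, map_neg, add_comm r, neg_add_cancel]
  simp only [map_sum]
  rw [Finset.sum_congr rfl fun q hq => Finset.sum_congr rfl (h q hq)]
  simp only [Finset.sum_add_distrib]
  rw [hanti, zero_add, ← lower_apply, Finset.sum_const, Int.card_Icc, add_sub_cancel_right,
    Int.toNat_natCast, Nat.cast_smul_eq_nsmul]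

/-- First order injectivity for two overlapping Toeplitz windows. Let `F₀ + t F₁` be the flattening
of the tensor `∑ a_{c-b} ⊗ b_b ⊗ c_c` over all `(b, c)` in one of the windows `b, c ≤ p`,
`p ≤ b, c`, or with `b ≤ c`, in which the terms with `c < b` are weighted by `1 + t b`. There is no
nonzero `ξ` in the kernel of `F₀` that extends to a solution of `(F₀ + t F₁)(ξ + t η) = O(t²)`. -/
theorem overlap_injective [CharZero K] [FiniteDimensional K V] (hF : ∀ v, F.translate 0 v = v)
    {ξ η : ℤ → ExteriorAlgebra K V} (hξ : ∀ b, ξ b ∈ ⋀[K]^p V) (hη : ∀ b, η b ∈ ⋀[K]^p V)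
    (h₀ : ∀ c ∈ Finset.Icc (0 : ℤ) (2 * p), ∑ b ∈ Finset.Icc (0 : ℤ) (2 * p),
      (if b ≤ c ∨ b ≤ p ∨ p ≤ c then (1 : K) else 0) • F.wedge (c - b) (ξ b) = 0)
    (h₁ : ∀ c ∈ Finset.Icc (0 : ℤ) (2 * p),
      ∑ b ∈ Finset.Icc (0 : ℤ) (2 * p),
          (if c < b ∧ (b ≤ p ∨ p ≤ c) then (b : K) else 0) • F.wedge (c - b) (ξ b) +
        ∑ b ∈ Finset.Icc (0 : ℤ) (2 * p),
          (if b ≤ c ∨ b ≤ p ∨ p ≤ c then (1 : K) else 0) • F.wedge (c - b) (η b) = 0) :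
    ∀ b ∈ Finset.Icc (0 : ℤ) (2 * p), ξ b = 0 := by
  set κ : ℤ → ExteriorAlgebra K V := fun n =>
    ∑ b ∈ Finset.Icc (0 : ℤ) (2 * p), F.coeff (n - b) (ξ b) with hκ
  set z : ExteriorAlgebra K V := ∑ b ∈ Finset.Icc (0 : ℤ) p, F.wedge (p - b) (ξ b) with hz
  have hzmem : z ∈ ⋀[K]^(p + 1) V := Submodule.sum_mem _ fun b _ => F.wedge_mem _ (hξ b)
  -- the columns `0, …, p`: the equations hold for the terms with `b ≤ p`, except in column `p`
  have hA : ∀ q : ℤ, 0 ≤ q → q ≤ p → κ q = F.cut (p - q) z := by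
    intro q hq hqp
    have h1 : κ q = ∑ b ∈ Finset.Icc (0 : ℤ) p, F.coeff (q - b) (ξ b) := by
      refine (Finset.sum_subset (Finset.Icc_subset_Icc_right (by omega)) ?_).symm
      intro b hb hb'
      rw [Finset.mem_Icc] at hb hb'
      exact F.coeff_of_neg (by omega) _
    have h2 : ∀ b ∈ Finset.Icc (0 : ℤ) p, F.coeff (q - b) (ξ b) =
        ∑ c ∈ Finset.Icc (0 : ℤ) (0 + p),
          F.coeff (0 + p - c) (F.cut (p - q) (F.wedge (c - b) (ξ b))) := by
      intro b hb
      rw [Finset.mem_Icc] at hb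
      rw [F.sum_coeff_cut_wedge le_rfl (hξ b) (by omega) (by omega)]
      congr 2
      ring
    rw [h1, Finset.sum_congr rfl h2, Finset.sum_comm,
      Finset.sum_eq_single_of_mem (p : ℤ) (Finset.mem_Icc.2 (by omega))]
    · rw [zero_add, sub_self, ← map_sum, F.coeff_zero, ← map_sum]
    · intro c hc hcp
      rw [Finset.mem_Icc] at hc
      rw [← map_sum, ← map_sum]
      have h3 := h₀ c (Finset.mem_Icc.2 (by omega))
      have h4 : ∑ b ∈ Finset.Icc (0 : ℤ) p, F.wedge (c - b) (ξ b) = 0 := by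
        rw [← h3]
        refine Finset.sum_subset_zero_on_sdiff (Finset.Icc_subset_Icc_right (by omega)) ?_ ?_
        · intro b hb
          simp only [Finset.mem_sdiff, Finset.mem_Icc] at hb
          rw [if_neg (by omega), zero_smul]
        · intro b hb
          rw [Finset.mem_Icc] at hb
          rw [if_pos (by omega), one_smul]
      rw [h4, map_zero, map_zero]
  -- the columns `p, …, 2p`: the equations hold for all the terms
  have hB : ∀ q : ℤ, 0 ≤ q → q ≤ p → κ (p + q) = 0 := by
    intro q hq hqp
    have h2 : ∀ b ∈ Finset.Icc (0 : ℤ) (2 * p), F.coeff (p + q - b) (ξ b) =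
        ∑ c ∈ Finset.Icc (p : ℤ) (p + p),
          F.coeff (p + p - c) (F.cut (p - q) (F.wedge (c - b) (ξ b))) := by
      intro b hb
      rw [Finset.mem_Icc] at hb
      rw [F.sum_coeff_cut_wedge le_rfl (hξ b) (by omega) (by omega)]
      congr 2
      ring
    rw [hκ]
    simp only
    rw [Finset.sum_congr rfl h2, Finset.sum_comm]
    refine Finset.sum_eq_zero fun c hc => ?_
    rw [Finset.mem_Icc] at hc
    rw [← map_sum, ← map_sum,
      show ∑ b ∈ Finset.Icc (0 : ℤ) (2 * p), F.wedge (c - b) (ξ b) = 0 from ?_,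
      map_zero, map_zero]
    rw [← h₀ c (Finset.mem_Icc.2 (by omega))]
    refine Finset.sum_congr rfl fun b _ => ?_
    rw [if_pos (by omega), one_smul]
  have hcut : F.cut 0 z = 0 := by
    have h1 := hA p (by omega) le_rfl
    have h2 := hB 0 le_rfl (by omega)
    rw [add_zero] at h2
    rw [sub_self, h2] at h1
    exact h1.symm
  have hneg : ∀ n : ℤ, n < 0 → κ n = 0 := by
    intro n hn
    refine Finset.sum_eq_zero fun b hb => ?_
    rw [Finset.mem_Icc] at hb
    exact F.coeff_of_neg (by omega) _
  -- the sums over the columns of a window telescope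
  have hM : ∀ (x : ExteriorAlgebra K V), x ∈ ⋀[K]^p V → ∀ b ∈ Finset.Icc (0 : ℤ) (2 * p),
      ∑ q ∈ Finset.Icc (1 : ℤ) p, F.cut 0 (F.cut q (∑ c ∈ Finset.Icc (0 : ℤ) (2 * p),
        F.coeff (p + q - c) ((if b ≤ c ∨ b ≤ p ∨ p ≤ c then (1 : K) else 0) •
          F.wedge (c - b) x))) = 0 := by
    intro x hx b hb
    rw [Finset.mem_Icc] at hb
    obtain ⟨c₀, hc₀⟩ : ∃ c₀ : ℤ, c₀ = if b ≤ p then 0 else (p : ℤ) := ⟨_, rfl⟩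
    rw [← F.sum_cut_cut_wedge_coeff_eq_zero hx hb hc₀]
    refine Finset.sum_congr rfl fun q hq => ?_
    rw [Finset.mem_Icc] at hq
    congr 2
    have h1 := F.sum_coeff_wedge (b := b) (c₀ := c₀) (c₁ := 2 * p) (by split_ifs at hc₀ <;> omega)
      (by split_ifs at hc₀ <;> omega) (p + q) x
    rw [F.coeff_of_neg (u := p + q - (2 * p + 1)) (by omega), map_zero, sub_zero] at h1
    rw [← h1]
    refine (Finset.sum_subset_zero_on_sdiff
      (Finset.Icc_subset_Icc_left (by split_ifs at hc₀ <;> omega)) ?_ ?_).symm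
    · intro c hc
      simp only [Finset.mem_sdiff, Finset.mem_Icc] at hc
      rw [if_neg (by split_ifs at hc₀ <;> omega), zero_smul, map_zero]
    · intro c hc
      rw [Finset.mem_Icc] at hc
      rw [if_pos (by split_ifs at hc₀ <;> omega), one_smul]
  have hL : ∀ b ∈ Finset.Icc (0 : ℤ) (2 * p),
      ∑ q ∈ Finset.Icc (1 : ℤ) p, F.cut 0 (F.cut q (∑ c ∈ Finset.Icc (0 : ℤ) (2 * p),
        F.coeff (p + q - c) ((if c < b ∧ (b ≤ p ∨ p ≤ c) then (b : K) else 0) •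
          F.wedge (c - b) (ξ b)))) =
      ∑ q ∈ Finset.Icc (1 : ℤ) p,
        F.cut 0 (F.wedge 0 (F.cut q ((b : K) • F.coeff (p + q - b) (ξ b)))) := by
    intro b hb
    rw [Finset.mem_Icc] at hb
    obtain ⟨c₀, hc₀⟩ : ∃ c₀ : ℤ, c₀ = if b ≤ p then 0 else (p : ℤ) := ⟨_, rfl⟩
    have h0 := congrArg ((b : K) • ·) (F.sum_cut_cut_wedge_coeff_eq_zero (hξ b) hb hc₀)
    simp only [smul_zero] at h0
    refine Eq.trans ?_ ((congrArg (_ + ·) h0).trans (add_zero _))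
    rw [Finset.smul_sum, ← Finset.sum_add_distrib]
    refine Finset.sum_congr rfl fun q hq => ?_
    rw [Finset.mem_Icc] at hq
    have h1 := F.sum_coeff_wedge (b := b) (c₀ := c₀) (c₁ := b - 1) (by split_ifs at hc₀ <;> omega)
      (by split_ifs at hc₀ <;> omega) (p + q) (ξ b)
    rw [sub_add_cancel, sub_self] at h1
    have h2 : ∑ c ∈ Finset.Icc (0 : ℤ) (2 * p),
        F.coeff (p + q - c) ((if c < b ∧ (b ≤ p ∨ p ≤ c) then (b : K) else 0) •
          F.wedge (c - b) (ξ b)) =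
        (b : K) • ∑ c ∈ Finset.Icc c₀ (b - 1), F.coeff (p + q - c) (F.wedge (c - b) (ξ b)) := by
      rw [Finset.smul_sum]
      refine (Finset.sum_subset_zero_on_sdiff
        (Finset.Icc_subset_Icc (by split_ifs at hc₀ <;> omega) (by omega)) ?_ ?_).symm
      · intro c hc
        simp only [Finset.mem_sdiff, Finset.mem_Icc] at hc
        rw [if_neg (by split_ifs at hc₀ <;> omega), zero_smul, map_zero]
      · intro c hc
        rw [Finset.mem_Icc] at hc
        rw [if_pos (by split_ifs at hc₀ <;> omega), map_smul]
    rw [h2, h1]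
    simp only [map_smul, map_sub, smul_sub]
    rw [F.cut_wedge (j := 0) (by omega) q, if_neg (by omega), zero_sub, map_neg, smul_neg,
      sub_neg_eq_add, add_comm]
  -- applying `∑_q a_0^* a_q^* ∑_c Φ_{p+q-c}` to the first order equation
  have hW : ∑ q ∈ Finset.Icc (1 : ℤ) p, F.cut 0 (F.wedge 0 (F.cut q
      (∑ b ∈ Finset.Icc (0 : ℤ) (2 * p), (b : K) • F.coeff (p + q - b) (ξ b)))) = 0 := by
    have h2 : ∑ q ∈ Finset.Icc (1 : ℤ) p, F.cut 0 (F.cut q (∑ c ∈ Finset.Icc (0 : ℤ) (2 * p),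
        F.coeff (p + q - c)
          (∑ b ∈ Finset.Icc (0 : ℤ) (2 * p),
            (if c < b ∧ (b ≤ p ∨ p ≤ c) then (b : K) else 0) • F.wedge (c - b) (ξ b) +
          ∑ b ∈ Finset.Icc (0 : ℤ) (2 * p),
            (if b ≤ c ∨ b ≤ p ∨ p ≤ c then (1 : K) else 0) • F.wedge (c - b) (η b)))) = 0 := by
      refine Finset.sum_eq_zero fun q _ => ?_
      rw [Finset.sum_eq_zero fun c hc => ?_, map_zero, map_zero]
      rw [h₁ c hc, map_zero]
    have h3 := Finset.sum_congr (rfl : Finset.Icc (0 : ℤ) (2 * p) = _) hL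
    have h4 := Finset.sum_congr (rfl : Finset.Icc (0 : ℤ) (2 * p) = _)
      fun b hb => hM (η b) (hη b) b hb
    rw [Finset.sum_comm] at h3 h4
    rw [Finset.sum_comm (t := Finset.Icc (1 : ℤ) p)] at h3
    simp only [map_add, map_sum, Finset.sum_add_distrib] at h2 h3 h4 ⊢
    conv at h3 => lhs; enter [2, q]; rw [Finset.sum_comm]
    conv at h4 => lhs; enter [2, q]; rw [Finset.sum_comm]
    rw [Finset.sum_const_zero] at h4
    rwa [h4, add_zero, h3] at h2
  have hW' : ∀ q ∈ Finset.Icc (1 : ℤ) p,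
      ∑ b ∈ Finset.Icc (0 : ℤ) (2 * p), (b : K) • F.coeff (p + q - b) (ξ b) =
        ∑ r ∈ Finset.Icc (1 : ℤ) p, F.power (q + r) (F.cut r z) := by
    intro q hq
    rw [Finset.mem_Icc] at hq
    rw [F.sum_smul_coeff_eq (by omega) (by omega)]
    change _ • κ (p + q) + ∑ j ∈ _, F.power j (κ (p + q - j)) = _
    rw [hB q (by omega) (by omega), smul_zero, zero_add]
    have h1 : ∑ r ∈ Finset.Icc (1 : ℤ) p, F.power (q + r) (F.cut r z) =
        ∑ j ∈ Finset.Icc (q + 1) (q + p), F.power j (F.cut (j - q) z) := by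
      rw [← Finset.map_add_left_Icc, Finset.sum_map]
      refine Finset.sum_congr rfl fun r _ => ?_
      rw [addLeftEmbedding_apply, add_sub_cancel_left]
    rw [h1]
    refine (Finset.sum_subset_zero_on_sdiff
      (Finset.Icc_subset_Icc (by omega) (by omega)) ?_ ?_).symm
    · intro j hj
      simp only [Finset.mem_sdiff, Finset.mem_Icc] at hj
      rcases lt_or_ge (p : ℤ) (j - q) with h | h
      · rw [hneg _ (by omega), map_zero]
      · rw [show p + q - j = p + (q - j) by ring, hB _ (by omega) (by omega), map_zero]
    · intro j hj
      rw [Finset.mem_Icc] at hj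
      rw [hA (p + q - j) (by omega) (by omega)]
      congr 3
      ring
  rw [Finset.sum_congr rfl fun q hq => by rw [hW' q hq], ← map_sum, ← map_sum, F.sum_cut_sum_power,
    F.cut_wedge (by omega), if_pos rfl, map_smul, cut_zero_lower, hcut, map_zero, smul_zero,
    map_zero, sub_zero] at hW
  have hκ0 : ∀ n ∈ Finset.Icc (0 : ℤ) (2 * p), κ n = 0 := by
    intro n hn
    rw [Finset.mem_Icc] at hn
    rcases le_or_gt (p : ℤ) n with h | h
    · have := hB (n - p) (by omega) (by omega)
      rwa [add_sub_cancel] at this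
    · have hp : (p : K) ≠ 0 := by
        rw [Nat.cast_ne_zero]
        omega
      rw [hA n hn.1 h.le, F.eq_zero_of_lower_eq_zero hF hzmem hcut
        ((smul_eq_zero.1 hW).resolve_left hp), map_zero]
  exact F.eq_zero_of_sum_coeff_eq_zero hκ0

end WindowFrame

/-! ### Pencils of linear maps -/

/-- If no nonzero kernel vector of `f₀` extends to a first order solution of
`(f₀ + t f₁)(x + t y) = O(t²)`, then `f₀ + t f₁` is injective for some `t`. Otherwise the
determinant of the pencil would vanish as a polynomial, and the lowest coefficient of a polynomial
kernel vector would be such a vector. -/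
theorem exists_injective_pencil {K V W : Type*} [Field K] [Infinite K] [AddCommGroup V]
    [Module K V] [AddCommGroup W] [Module K W] [FiniteDimensional K V] [FiniteDimensional K W]
    (hVW : Module.finrank K V = Module.finrank K W) (f₀ f₁ : V →ₗ[K] W)
    (h : ∀ x y, f₀ x = 0 → f₁ x + f₀ y = 0 → x = 0) :
    ∃ t : K, Function.Injective (f₀ + t • f₁) := by
  classical
  set bV := Module.finBasisOfFinrankEq K V hVW
  set bW := Module.finBasis K W
  set M₀ := LinearMap.toMatrix bV bW f₀ with hM₀
  set M₁ := LinearMap.toMatrix bV bW f₁ with hM₁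
  set M : Matrix _ _ (Polynomial K) :=
    M₀.map Polynomial.C + (Polynomial.X : Polynomial K) • M₁.map Polynomial.C with hM
  have hmul : ∀ (f : V →ₗ[K] W) (v : Fin (Module.finrank K W) → K),
      (LinearMap.toMatrix bV bW f).mulVec v = bW.equivFun (f (bV.equivFun.symm v)) := by
    intro f v
    have := LinearMap.toMatrix_mulVec_repr bV bW f (bV.equivFun.symm v)
    rw [← Module.Basis.equivFun_apply, LinearEquiv.apply_symm_apply] at this
    rw [this, Module.Basis.equivFun_apply]
  have hdet : M.det ≠ 0 := by
    intro hdet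
    obtain ⟨v, hv, hMv⟩ := Matrix.exists_mulVec_eq_zero_iff.2 hdet
    have hsucc : ∀ n : ℕ, M₁.mulVec (fun i => (v i).coeff n) +
        M₀.mulVec (fun i => (v i).coeff (n + 1)) = 0 := by
      intro n
      ext i
      have := congrArg (fun q : Polynomial K => q.coeff (n + 1)) (congrFun hMv i)
      simp only [hM, Matrix.mulVec, dotProduct, Matrix.add_apply, Matrix.smul_apply,
        Matrix.map_apply, smul_eq_mul, add_mul, mul_assoc, Polynomial.finsetSum_coeff,
        Polynomial.coeff_add, Polynomial.coeff_C_mul, Polynomial.coeff_X_mul, Pi.zero_apply,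
        Polynomial.coeff_zero, Finset.sum_add_distrib] at this
      simp only [Matrix.mulVec, dotProduct, Pi.add_apply, Pi.zero_apply]
      rw [add_comm]
      exact this
    have hzero : M₀.mulVec (fun i => (v i).coeff 0) = 0 := by
      ext i
      have := congrArg (fun q : Polynomial K => q.coeff 0) (congrFun hMv i)
      simp only [hM, Matrix.mulVec, dotProduct, Matrix.add_apply, Matrix.smul_apply,
        Matrix.map_apply, smul_eq_mul, add_mul, mul_assoc, Polynomial.finsetSum_coeff,
        Polynomial.coeff_add, Polynomial.coeff_C_mul, Polynomial.coeff_X_mul_zero, Pi.zero_apply,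
        Polynomial.coeff_zero, add_zero] at this
      exact this
    have hcoeff : ∀ n : ℕ, (fun i => (v i).coeff n) = 0 := by
      have hstep : ∀ n : ℕ, M₀.mulVec (fun i => (v i).coeff n) = 0 →
          (fun i => (v i).coeff n) = 0 := by
        intro n hn
        have h1 := h (bV.equivFun.symm fun i => (v i).coeff n)
          (bV.equivFun.symm fun i => (v i).coeff (n + 1)) ?_ ?_
        · exact (LinearEquiv.map_eq_zero_iff _).1 h1
        · rw [hM₀, hmul] at hn
          exact (LinearEquiv.map_eq_zero_iff _).1 hn
        · have h2 := hsucc n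
          rw [hM₀, hM₁, hmul, hmul, ← map_add] at h2
          exact (LinearEquiv.map_eq_zero_iff _).1 h2
      intro n
      induction n with
      | zero => exact hstep 0 hzero
      | succ n ih =>
        refine hstep (n + 1) ?_
        have h2 := hsucc n
        rwa [ih, Matrix.mulVec_zero, zero_add] at h2
    refine hv ?_
    ext i n
    exact congrFun (hcoeff n) i
  obtain ⟨t, ht⟩ : ∃ t, M.det.eval t ≠ 0 := by
    by_contra! hcon
    exact hdet (Polynomial.funext fun t => by rw [hcon t, Polynomial.eval_zero])
  refine ⟨t, ?_⟩
  rw [← LinearMap.ker_eq_bot, LinearMap.ker_eq_bot']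
  intro x hx
  have hMt : (Polynomial.evalRingHom t).mapMatrix M = LinearMap.toMatrix bV bW (f₀ + t • f₁) := by
    rw [map_add (LinearMap.toMatrix bV bW), map_smul, ← hM₀, ← hM₁]
    ext i j
    simp only [hM, RingHom.mapMatrix_apply, Matrix.map_apply, Matrix.add_apply, Matrix.smul_apply,
      smul_eq_mul, map_add, Polynomial.eval_mul, Polynomial.coe_evalRingHom, Polynomial.eval_C,
      Polynomial.eval_X]
  rw [← Polynomial.coe_evalRingHom, RingHom.map_det, hMt] at ht
  have h3 := hmul (f₀ + t • f₁) (bV.equivFun x)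
  rw [LinearEquiv.symm_apply_apply, hx, map_zero] at h3
  exact (LinearEquiv.map_eq_zero_iff _).1 (Matrix.eq_zero_of_mulVec_eq_zero ht h3)

/-! ### Flattenings in coordinates -/

section Coordinates

variable {A : Type*} [AddCommGroup A] [Module ℂ A]

/-- The tensor `∑ a_{b,c} ⊗ b_b ⊗ c_c` with entries `a_{b,c}` in `A`. -/
noncomputable def entryTensor {m n : ℕ} (a : Fin m → Fin n → A) :
    A ⊗[ℂ] ((Fin m → ℂ) ⊗[ℂ] (Fin n → ℂ)) :=
  ∑ b, ∑ c, a b c ⊗ₜ[ℂ] (stdBasis m b ⊗ₜ[ℂ] stdBasis n c)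

/-- The Young flattening of `entryTensor a` in coordinates, `(ω_b)_b ↦ (∑_b ω_b ∧ a_{b,c})_c`. -/
noncomputable def entryFlattening (p : ℕ) {m n : ℕ} (a : Fin m → Fin n → A) :
    (Fin m → ⋀[ℂ]^p A) →ₗ[ℂ] (Fin n → ⋀[ℂ]^(p + 1) A) :=
  LinearMap.pi fun c => ∑ b, wedgeRight A p (a b c) ∘ₗ LinearMap.proj b

theorem entryFlattening_apply (p : ℕ) {m n : ℕ} (a : Fin m → Fin n → A) (ω : Fin m → ⋀[ℂ]^p A)
    (c : Fin n) : entryFlattening p a ω c = ∑ b, wedgeRight A p (a b c) (ω b) := by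
  simp [entryFlattening]

theorem coe_entryFlattening_apply (p : ℕ) {m n : ℕ} (a : Fin m → Fin n → A)
    (ω : Fin m → ⋀[ℂ]^p A) (c : Fin n) :
    (entryFlattening p a ω c : ExteriorAlgebra ℂ A) =
      (-1 : ℂ) ^ p • ∑ b, ExteriorAlgebra.ι ℂ (a b c) * (ω b : ExteriorAlgebra ℂ A) := by
  rw [entryFlattening_apply, Finset.smul_sum, AddSubmonoidClass.coe_finsetSum]
  exact Finset.sum_congr rfl fun b _ => mul_ι_eq_smul _ (ω b).2

theorem youngFlattening_entryTensor (p : ℕ) {m n : ℕ} (a : Fin m → Fin n → A)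
    (ω : Fin m → ⋀[ℂ]^p A) :
    youngFlattening A _ _ p (entryTensor a) (∑ b, ω b ⊗ₜ[ℂ] (stdBasis m).dualBasis b) =
      ∑ c, entryFlattening p a ω c ⊗ₜ[ℂ] stdBasis n c := by
  have h : ∀ b, youngFlattening A _ _ p (entryTensor a) (ω b ⊗ₜ[ℂ] (stdBasis m).dualBasis b) =
      ∑ c, wedgeRight A p (a b c) (ω b) ⊗ₜ[ℂ] stdBasis n c := by
    intro b
    simp only [entryTensor, map_sum, LinearMap.sum_apply, youngFlattening_tmul,
      Module.Basis.dualBasis_apply_self]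
    rw [Finset.sum_eq_single_of_mem b (Finset.mem_univ b)]
    · simp only [if_pos, one_smul]
    · intro b' _ hb
      simp only [if_neg hb, zero_smul, TensorProduct.tmul_zero, Finset.sum_const_zero]
  simp only [map_sum, h, entryFlattening_apply, TensorProduct.sum_tmul]
  exact Finset.sum_comm

theorem injective_youngFlattening (p : ℕ) {m n : ℕ} {a : Fin m → Fin n → A}
    (h : Function.Injective (entryFlattening p a)) :
    Function.Injective (youngFlattening A _ _ p (entryTensor a)) := by
  refine (injective_iff_map_eq_zero _).2 fun x hx => ?_
  obtain ⟨ω, rfl⟩ := TensorProduct.eq_repr_basis_right (stdBasis m).dualBasis x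
  have hsum : ω.sum (fun b y => y ⊗ₜ[ℂ] (stdBasis m).dualBasis b) =
      ∑ b, ω b ⊗ₜ[ℂ] (stdBasis m).dualBasis b :=
    Finsupp.sum_fintype _ _ fun _ => TensorProduct.zero_tmul _ _
  rw [hsum, youngFlattening_entryTensor] at hx
  have hsum' : (Finsupp.equivFunOnFinite.symm (entryFlattening p a ω)).sum
      (fun c y => y ⊗ₜ[ℂ] stdBasis n c) = 0 := by
    rw [Finsupp.sum_fintype _ (fun c y => y ⊗ₜ[ℂ] stdBasis n c)
      fun _ => TensorProduct.zero_tmul _ _]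
    exact hx
  have h1 := TensorProduct.sum_tmul_basis_right_eq_zero (stdBasis n) _ hsum'
  have h2 : entryFlattening p a ω = 0 := by
    ext1 c
    exact DFunLike.congr_fun h1 c
  have h3 : (ω : Fin m → ⋀[ℂ]^p A) = 0 := (injective_iff_map_eq_zero _).1 h _ h2
  rw [hsum]
  exact Finset.sum_eq_zero fun b _ => by rw [h3, Pi.zero_apply, TensorProduct.zero_tmul]

end Coordinates

theorem sum_Icc_int_eq_sum_fin {M : Type*} [AddCommMonoid M] (f : ℤ → M) {m : ℕ} {u : ℤ}
    (hu : u + 1 = m) : ∑ z ∈ Finset.Icc 0 u, f z = ∑ b : Fin m, f b := by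
  refine (Finset.sum_nbij (fun b : Fin m => (b : ℤ)) ?_ ?_ ?_ fun _ _ => rfl).symm
  · intro b _
    have := b.2
    rw [Finset.mem_Icc]
    omega
  · intro b _ b' _ h
    exact Fin.ext (Int.ofNat_inj.1 h)
  · intro z hz
    rw [Finset.mem_coe, Finset.mem_Icc] at hz
    exact ⟨⟨z.toNat, by omega⟩, Finset.mem_coe.2 (Finset.mem_univ _), by simp; omega⟩

/-- The standard frame of `ℂ^N`, in which `a_j` is the standard basis vector with (zero-based)
number `j + p`. -/
noncomputable def stdFrame {N p : ℕ} (hN : 2 * p + 1 ≤ N) : WindowFrame ℂ (Fin N → ℂ) p where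
  vec j := if h : -(p : ℤ) ≤ j ∧ j ≤ p then stdBasis N ⟨(j + p).toNat, by omega⟩ else 0
  dual j := if h : -(p : ℤ) ≤ j ∧ j ≤ p then
    LinearMap.proj (φ := fun _ : Fin N => ℂ) ⟨(j + p).toNat, by omega⟩ else 0
  vec_eq_zero j h := dif_neg h
  dual_eq_zero j h := dif_neg h
  dual_vec i j h₁ h₂ := by
    rw [dif_pos (c := -(p : ℤ) ≤ j ∧ j ≤ p) ⟨h₁, h₂⟩]
    split_ifs with hi hij hij
    · subst hij
      simp
    · rw [LinearMap.proj_apply, Pi.basisFun_apply, Pi.single_eq_of_ne]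
      rw [Ne, Fin.mk.injEq]
      omega
    · omega
    · rfl

theorem stdFrame_translate_zero {p : ℕ} (v : Fin (2 * p + 1) → ℂ) :
    (stdFrame le_rfl : WindowFrame ℂ _ p).translate 0 v = v := by
  rw [WindowFrame.translate_apply]
  have h : Finset.Icc (-(p : ℤ)) p = (Finset.univ : Finset (Fin (2 * p + 1))).image
      (fun i : Fin (2 * p + 1) => ((i : ℕ) : ℤ) - p) := by
    ext j
    simp only [Finset.mem_Icc, Finset.mem_image, Finset.mem_univ, true_and]
    constructor
    · intro hj
      exact ⟨⟨(j + p).toNat, by omega⟩, by simp; omega⟩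
    · rintro ⟨i, rfl⟩
      omega
  rw [h, Finset.sum_image (fun i _ j _ hij => Fin.ext (by simpa using hij))]
  conv_rhs => rw [← (stdBasis (2 * p + 1)).sum_repr v]
  refine Finset.sum_congr rfl fun i _ => ?_
  have hi := i.2
  simp only [stdFrame, add_zero]
  rw [dif_pos (by omega), dif_pos (by omega)]
  simp

/-! ### Tensors with an injective flattening -/

/-- `T_{m,p}(λ)` as a tensor with entries in `A`: the entry in row `b` and column `c` is `a_{c-b}`,
times `λ_{b-c,c+1}` below the diagonal. -/
theorem tensorT_eq_entryTensor {m p : ℕ} (l : LambdaIndex m p → ℂ) :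
    tensorT l = entryTensor fun b c : Fin m =>
      (if (b : ℤ) ≤ c then (1 : ℂ) else lam l (b - c) (c + 1)) •
        (stdFrame le_rfl : WindowFrame ℂ (Fin (2 * p + 1) → ℂ) p).vec (c - b) := by
  have hvec : ∀ b c : Fin m,
      (if (b : ℤ) ≤ c then (1 : ℂ) else lam l (b - c) (c + 1)) •
        (stdFrame le_rfl : WindowFrame ℂ (Fin (2 * p + 1) → ℂ) p).vec (c - b) =
      ∑ i : Fin (2 * p + 1), sliceX l ((i : ℤ) - p) b c • stdBasis (2 * p + 1) i := by
    intro b c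
    by_cases h : -(p : ℤ) ≤ c - b ∧ (c : ℤ) - b ≤ p
    · have hi : ((((c : ℤ) - b + p).toNat : ℕ) : ℤ) = c - b + p := Int.toNat_of_nonneg (by omega)
      rw [Finset.sum_eq_single_of_mem ⟨((c : ℤ) - b + p).toNat, by omega⟩ (Finset.mem_univ _)]
      · simp only [stdFrame, dif_pos h, sliceX, Matrix.of_apply, hi, add_sub_cancel_right]
        rw [if_pos (show (c : ℤ) = b + (c - b) by ring)]
        simp only [sub_nonneg, neg_sub]
      · intro i _ hne
        rw [sliceX, Matrix.of_apply, if_neg, zero_smul]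
        intro hc
        exact hne (Fin.ext (by simp only; omega))
    · rw [WindowFrame.vec_eq_zero _ _ h, smul_zero]
      refine (Finset.sum_eq_zero fun i _ => ?_).symm
      have := i.2
      rw [sliceX, Matrix.of_apply, if_neg (by omega), zero_smul]
  simp only [tensorT, entryTensor, hvec, TensorProduct.tmul_sum, TensorProduct.sum_tmul]
  rw [Finset.sum_comm]
  refine Finset.sum_congr rfl fun b _ => ?_
  rw [Finset.sum_comm]
  refine Finset.sum_congr rfl fun c _ => Finset.sum_congr rfl fun i _ => ?_
  rw [TensorProduct.tmul_smul, TensorProduct.smul_tmul']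

theorem entryFlattening_add_smul {A : Type*} [AddCommGroup A] [Module ℂ A] (p : ℕ) {m n : ℕ}
    (a₀ a₁ : Fin m → Fin n → A) (t : ℂ) :
    entryFlattening p (fun b c => a₀ b c + t • a₁ b c) =
      entryFlattening p a₀ + t • entryFlattening p a₁ := by
  refine LinearMap.ext fun ω => ?_
  ext1 c
  simp only [LinearMap.add_apply, LinearMap.smul_apply, Pi.add_apply, Pi.smul_apply,
    entryFlattening_apply, Finset.smul_sum, ← Finset.sum_add_distrib, map_add, map_smul]

/-- The extension by zero of a family indexed by `Fin m` to the integers. -/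
noncomputable def extendInt {A : Type*} [AddCommGroup A] [Module ℂ A] {m p : ℕ}
    (ω : Fin m → ⋀[ℂ]^p A) (z : ℤ) : ExteriorAlgebra ℂ A :=
  if h : 0 ≤ z ∧ z < m then ω ⟨z.toNat, by omega⟩ else 0

theorem extendInt_mem {A : Type*} [AddCommGroup A] [Module ℂ A] {m p : ℕ}
    (ω : Fin m → ⋀[ℂ]^p A) (z : ℤ) : extendInt ω z ∈ ⋀[ℂ]^p A := by
  rw [extendInt]
  split_ifs
  · exact Subtype.mem _
  · exact Submodule.zero_mem _

theorem extendInt_natCast {A : Type*} [AddCommGroup A] [Module ℂ A] {m p : ℕ}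
    (ω : Fin m → ⋀[ℂ]^p A) (b : Fin m) : extendInt ω b = ω b := by
  rw [extendInt, dif_pos ⟨by omega, by omega⟩]
  rfl

/-- Two diagonal Toeplitz blocks of size `p + 1` give a tensor whose Young flattening is
injective. -/
theorem exists_injective_youngFlattening_even (p : ℕ) :
    ∃ T : TensorSpace (2 * p + 2) (2 * p + 2) (2 * p + 2),
      Function.Injective (youngFlattening _ _ _ p T) := by
  set F : WindowFrame ℂ (Fin (2 * p + 2) → ℂ) p := stdFrame (by omega) with hF
  refine ⟨entryTensor fun b c : Fin (2 * p + 2) =>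
    if ((b : ℤ) ≤ p ↔ (c : ℤ) ≤ p) then F.vec (c - b) else 0, injective_youngFlattening p ?_⟩
  refine (injective_iff_map_eq_zero _).2 fun ω hω => ?_
  have hsum : ∀ c ∈ Finset.Icc (0 : ℤ) (2 * p + 1), ∑ b ∈ Finset.Icc (0 : ℤ) (2 * p + 1),
      (if (b ≤ p ↔ c ≤ p) then F.wedge (c - b) (extendInt ω b) else 0) = 0 := by
    intro c hc
    rw [Finset.mem_Icc] at hc
    obtain ⟨c, rfl⟩ : ∃ c' : Fin (2 * p + 2), (c' : ℤ) = c := ⟨⟨c.toNat, by omega⟩, by simp; omega⟩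
    have h := congrArg Subtype.val (congrFun hω c)
    rw [coe_entryFlattening_apply, Pi.zero_apply, Submodule.coe_zero, smul_eq_zero] at h
    have h' := h.resolve_left (pow_ne_zero _ (neg_ne_zero.2 one_ne_zero))
    rw [sum_Icc_int_eq_sum_fin _ (m := 2 * p + 2) (by push_cast; ring)]
    refine Eq.trans ?_ h'
    refine Finset.sum_congr rfl fun b _ => ?_
    rw [extendInt_natCast]
    split_ifs
    · rfl
    · rw [map_zero, zero_mul]
  have h1 := F.toeplitz_injective le_rfl (extendInt_mem ω) fun c hc => by
    rw [Finset.mem_Icc] at hc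
    rw [← hsum c (Finset.mem_Icc.2 (by omega))]
    refine Finset.sum_subset_zero_on_sdiff (Finset.Icc_subset_Icc_right (by omega)) ?_ ?_
    · intro b hb
      simp only [Finset.mem_sdiff, Finset.mem_Icc] at hb
      rw [if_neg (by omega)]
    · intro b hb
      rw [Finset.mem_Icc] at hb
      rw [if_pos (by omega)]
  have h2 := F.toeplitz_injective le_rfl (x := fun b => extendInt ω (b + (p + 1)))
    (fun b => extendInt_mem ω _) fun c hc => by
    rw [Finset.mem_Icc] at hc
    rw [← hsum (c + (p + 1)) (Finset.mem_Icc.2 (by omega))]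
    rw [show ∑ b ∈ Finset.Icc (0 : ℤ) p, F.wedge (c - b) (extendInt ω (b + (p + 1))) =
        ∑ b ∈ Finset.Icc (0 + ((p : ℤ) + 1)) (p + (p + 1)),
          F.wedge (c + (p + 1) - b) (extendInt ω b) by
      rw [← Finset.map_add_right_Icc, Finset.sum_map]
      refine Finset.sum_congr rfl fun b _ => ?_
      rw [addRightEmbedding_apply, add_sub_add_right_eq_sub]]
    refine Finset.sum_subset_zero_on_sdiff (Finset.Icc_subset_Icc (by omega) (by omega)) ?_ ?_
    · intro b hb
      simp only [Finset.mem_sdiff, Finset.mem_Icc] at hb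
      rw [if_neg (by omega)]
    · intro b hb
      rw [Finset.mem_Icc] at hb
      rw [if_pos (by omega)]
  ext1 b
  refine Subtype.ext ?_
  rw [← extendInt_natCast, Pi.zero_apply, Submodule.coe_zero]
  have hb := b.2
  rcases le_or_gt (b : ℤ) p with h | h
  · exact h1 b (Finset.mem_Icc.2 (by omega))
  · have := h2 (b - (p + 1)) (Finset.mem_Icc.2 (by omega))
    simpa using this

theorem finrank_exteriorPower_middle (p : ℕ) :
    Module.finrank ℂ (⋀[ℂ]^p (Fin (2 * p + 1) → ℂ)) =
      Module.finrank ℂ (⋀[ℂ]^(p + 1) (Fin (2 * p + 1) → ℂ)) := by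
  rw [exteriorPower.finrank_eq, exteriorPower.finrank_eq, Module.finrank_fin_fun]
  exact (Nat.choose_symm_of_eq_add (by ring)).symm

/-- The flattening of `T_m(λ)`, `m = 2p + 1`, is injective for some `λ`. The parameters are
`λ_{k,α} = 1 + t (k + α - 1)` inside the two diagonal blocks `b, c ≤ p` and `p ≤ b, c`, and `0`
elsewhere. -/
theorem exists_injective_youngFlattening_odd (p : ℕ) :
    ∃ l : LambdaIndex (2 * p + 1) p → ℂ,
      Function.Injective (youngFlattening _ _ _ p (tensorT l)) := by
  set F : WindowFrame ℂ (Fin (2 * p + 1) → ℂ) p := stdFrame le_rfl with hF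
  set a₀ : Fin (2 * p + 1) → Fin (2 * p + 1) → Fin (2 * p + 1) → ℂ := fun b c =>
    (if (b : ℤ) ≤ c ∨ (b : ℤ) ≤ p ∨ (p : ℤ) ≤ c then (1 : ℂ) else 0) • F.vec (c - b) with ha₀
  set a₁ : Fin (2 * p + 1) → Fin (2 * p + 1) → Fin (2 * p + 1) → ℂ := fun b c =>
    (if (c : ℤ) < b ∧ ((b : ℤ) ≤ p ∨ (p : ℤ) ≤ c) then ((b : ℤ) : ℂ) else 0) • F.vec (c - b)
    with ha₁
  obtain ⟨t, ht⟩ : ∃ t : ℂ,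
      Function.Injective (entryFlattening p a₀ + t • entryFlattening p a₁) := by
    refine exists_injective_pencil ?_ _ _ ?_
    · rw [Module.finrank_pi_fintype, Module.finrank_pi_fintype, finrank_exteriorPower_middle]
    · intro ξ η h₀ h₁
      have hsign : ((-1 : ℂ) ^ p) ≠ 0 := pow_ne_zero _ (neg_ne_zero.2 one_ne_zero)
      have key := F.overlap_injective (ξ := extendInt ξ) (η := extendInt η) stdFrame_translate_zero
        (extendInt_mem ξ) (extendInt_mem η) ?_ ?_
      · ext1 b
        refine Subtype.ext ?_
        rw [← extendInt_natCast, Pi.zero_apply, Submodule.coe_zero]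
        have hb := b.2
        exact key b (Finset.mem_Icc.2 (by omega))
      · intro c hc
        rw [Finset.mem_Icc] at hc
        obtain ⟨c, rfl⟩ : ∃ c' : Fin (2 * p + 1), (c' : ℤ) = c :=
          ⟨⟨c.toNat, by omega⟩, by simp; omega⟩
        have h := congrArg Subtype.val (congrFun h₀ c)
        rw [coe_entryFlattening_apply, Pi.zero_apply, Submodule.coe_zero, smul_eq_zero] at h
        rw [sum_Icc_int_eq_sum_fin _ (m := 2 * p + 1) (by push_cast; ring), ← h.resolve_left hsign]
        refine Finset.sum_congr rfl fun b _ => ?_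
        rw [extendInt_natCast, ha₀, map_smul, smul_mul_assoc]
        rfl
      · intro c hc
        rw [Finset.mem_Icc] at hc
        obtain ⟨c, rfl⟩ : ∃ c' : Fin (2 * p + 1), (c' : ℤ) = c :=
          ⟨⟨c.toNat, by omega⟩, by simp; omega⟩
        have h := congrArg Subtype.val (congrFun h₁ c)
        rw [Pi.add_apply, Submodule.coe_add, coe_entryFlattening_apply, coe_entryFlattening_apply,
          Pi.zero_apply, Submodule.coe_zero, ← smul_add, smul_eq_zero] at h
        rw [sum_Icc_int_eq_sum_fin _ (m := 2 * p + 1) (by push_cast; ring),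
          sum_Icc_int_eq_sum_fin _ (m := 2 * p + 1) (by push_cast; ring), ← h.resolve_left hsign]
        congr 1
        · refine Finset.sum_congr rfl fun b _ => ?_
          rw [extendInt_natCast, ha₁, map_smul, smul_mul_assoc]
          rfl
        · refine Finset.sum_congr rfl fun b _ => ?_
          rw [extendInt_natCast, ha₀, map_smul, smul_mul_assoc]
          rfl
  refine ⟨fun x => if x.1.1 + x.1.2 ≤ p + 1 ∨ (p : ℤ) + 1 ≤ x.1.2 then
    1 + t * ((x.1.1 + x.1.2 - 1 : ℤ) : ℂ) else 0, ?_⟩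
  have hentry : ∀ b c : Fin (2 * p + 1), (if (b : ℤ) ≤ c then (1 : ℂ) else
      lam (fun x : LambdaIndex (2 * p + 1) p => if x.1.1 + x.1.2 ≤ p + 1 ∨ (p : ℤ) + 1 ≤ x.1.2 then
        1 + t * ((x.1.1 + x.1.2 - 1 : ℤ) : ℂ) else 0) (b - c) (c + 1)) • F.vec (c - b) =
      a₀ b c + t • a₁ b c := by
    intro b c
    simp only [ha₀, ha₁]
    rw [smul_smul, ← add_smul]
    by_cases h : -(p : ℤ) ≤ c - b ∧ (c : ℤ) - b ≤ p
    · congr 1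
      have hb := b.2
      by_cases hbc : (b : ℤ) ≤ c
      · rw [if_pos hbc, if_pos (Or.inl hbc), if_neg (by omega), mul_zero, add_zero]
      · rw [if_neg hbc, lam, dif_pos (by push_cast; omega)]
        simp only
        by_cases hw : (b : ℤ) ≤ p ∨ (p : ℤ) ≤ c
        · rw [if_pos (by omega), if_pos (Or.inr hw), if_pos (by omega)]
          congr 3
          ring
        · rw [if_neg (by omega), if_neg (by omega), if_neg (by omega), mul_zero, add_zero]
    · rw [F.vec_eq_zero _ h, smul_zero, smul_zero]
  rw [← entryFlattening_add_smul] at ht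
  have hT := injective_youngFlattening p ht
  rw [← funext fun b => funext fun c => hentry b c, ← tensorT_eq_entryTensor] at hT
  exact hT

/-! ### The flattening of a tensor of low rank -/

section Rank

variable {K V : Type*} [Field K] [AddCommGroup V] [Module K V]

theorem ι_mul_mul_ι_self (a : V) (x : ExteriorAlgebra K V) :
    ExteriorAlgebra.ι K a * x * ExteriorAlgebra.ι K a = 0 := by
  induction x using CliffordAlgebra.left_induction with
  | algebraMap r =>
    rw [← Algebra.commutes, mul_assoc]
    exact (congrArg _ (ExteriorAlgebra.ι_sq_zero a)).trans (mul_zero _)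
  | add x y hx hy => rw [mul_add, add_mul, hx, hy, add_zero]
  | ι_mul x v hx =>
    change ExteriorAlgebra.ι K a * (ExteriorAlgebra.ι K v * x) * ExteriorAlgebra.ι K a = 0
    rw [ι_mul_ι_mul_comm, neg_mul, mul_assoc, hx, mul_zero, neg_zero]

/-- Only the image of `x` in the exterior algebra of the quotient by `a` matters for `x ∧ a`. -/
theorem map_mul_ι_eq (a : V) (φ : Module.Dual K V) (x : ExteriorAlgebra K V) :
    ExteriorAlgebra.map (LinearMap.id - φ.smulRight a) x * ExteriorAlgebra.ι K a =
      x * ExteriorAlgebra.ι K a := by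
  induction x using CliffordAlgebra.left_induction with
  | algebraMap r => rw [AlgHom.commutes]
  | add x y hx hy => rw [map_add, add_mul, add_mul, hx, hy]
  | ι_mul x v hx =>
    change ExteriorAlgebra.map _ (ExteriorAlgebra.ι K v * x) * ExteriorAlgebra.ι K a =
      ExteriorAlgebra.ι K v * x * ExteriorAlgebra.ι K a
    rw [map_mul, ExteriorAlgebra.map_apply_ι, mul_assoc, hx, mul_assoc, LinearMap.sub_apply,
      LinearMap.smulRight_apply, LinearMap.id_apply, map_sub, map_smul, sub_mul, smul_mul_assoc,
      ← mul_assoc (ExteriorAlgebra.ι K a), ι_mul_mul_ι_self, smul_zero, sub_zero]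

theorem coe_exteriorPower_map {W : Type*} [AddCommGroup W] [Module K W] (f : V →ₗ[K] W) {n : ℕ}
    (x : ⋀[K]^n V) :
    (exteriorPower.map n f x : ExteriorAlgebra K W) = ExteriorAlgebra.map f x := by
  have h : (⋀[K]^n W).subtype ∘ₗ exteriorPower.map n f =
      (ExteriorAlgebra.map f).toLinearMap ∘ₗ (⋀[K]^n V).subtype := by
    refine exteriorPower.linearMap_ext ?_
    ext v
    simp [ExteriorAlgebra.map_apply_ιMulti]
  exact LinearMap.congr_fun h x

end Rank

section RangeSum

variable {K V : Type*} [Field K] [AddCommMonoid V] [Module K V]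

theorem finrank_range_add_le {W : Type*} [AddCommGroup W] [Module K W] [FiniteDimensional K W]
    (f g : V →ₗ[K] W) :
    Module.finrank K (LinearMap.range (f + g)) ≤
      Module.finrank K (LinearMap.range f) + Module.finrank K (LinearMap.range g) :=
  (Submodule.finrank_mono (LinearMap.range_add_le f g)).trans
    (Submodule.finrank_add_le_finrank_add_finrank _ _)

theorem finrank_range_sum_le {W : Type*} [AddCommGroup W] [Module K W] [FiniteDimensional K W]
    {ι : Type*} (s : Finset ι) (f : ι → V →ₗ[K] W) :
    Module.finrank K (LinearMap.range (∑ i ∈ s, f i)) ≤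
      ∑ i ∈ s, Module.finrank K (LinearMap.range (f i)) := by
  classical
  induction s using Finset.induction_on with
  | empty => rw [Finset.sum_empty, Finset.sum_empty, LinearMap.range_zero, finrank_bot]
  | insert i s hi ih =>
    rw [Finset.sum_insert hi, Finset.sum_insert hi]
    exact (finrank_range_add_le _ _).trans (Nat.add_le_add_left ih _)

theorem finrank_range_map_sum_le {U W : Type*} [AddCommMonoid U] [Module K U] [AddCommGroup W]
    [Module K W] [FiniteDimensional K W] (Φ : U →ₗ[K] V →ₗ[K] W) {r N : ℕ} (u : Fin r → U)
    (h : ∀ i, Module.finrank K (LinearMap.range (Φ (u i))) ≤ N) :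
    Module.finrank K (LinearMap.range (Φ (∑ i, u i))) ≤ r * N := by
  rw [map_sum]
  refine (finrank_range_sum_le _ _).trans ((Finset.sum_le_sum fun i _ => h i).trans ?_)
  rw [Finset.sum_const, Finset.card_univ, Fintype.card_fin, smul_eq_mul]

end RangeSum

/-- Right multiplication by a vector `a` factors through the exterior power of a hyperplane that
does not contain `a`. -/
theorem finrank_range_wedgeRight_le (p n : ℕ) (a : Fin (n + 1) → ℂ) :
    Module.finrank ℂ (LinearMap.range (wedgeRight (Fin (n + 1) → ℂ) p a)) ≤ n.choose p := by
  by_cases ha : a = 0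
  · subst ha
    rw [map_zero, LinearMap.range_zero, finrank_bot]
    exact Nat.zero_le _
  obtain ⟨i, hi⟩ := Function.ne_iff.1 ha
  set φ : Module.Dual ℂ (Fin (n + 1) → ℂ) := (a i)⁻¹ • LinearMap.proj i with hφ
  have hφa : φ a = 1 := by
    simpa [hφ] using inv_mul_cancel₀ hi
  have hφ0 : φ ≠ 0 := by
    intro h
    rw [h, LinearMap.zero_apply] at hφa
    exact zero_ne_one hφa
  have hmem : ∀ v, (LinearMap.id - φ.smulRight a : (Fin (n + 1) → ℂ) →ₗ[ℂ] _) v ∈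
      LinearMap.ker φ := by
    intro v
    simp [hφa]
  set π := LinearMap.codRestrict (LinearMap.ker φ) (LinearMap.id - φ.smulRight a) hmem with hπ
  have hfac : wedgeRight (Fin (n + 1) → ℂ) p a =
      (wedgeRight (Fin (n + 1) → ℂ) p a ∘ₗ exteriorPower.map p (LinearMap.ker φ).subtype) ∘ₗ
        exteriorPower.map p π := by
    refine LinearMap.ext fun x => Subtype.ext ?_
    rw [LinearMap.comp_assoc, ← exteriorPower.map_comp, hπ, LinearMap.subtype_comp_codRestrict]
    change (x : ExteriorAlgebra ℂ _) * ExteriorAlgebra.ι ℂ a =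
      ((exteriorPower.map p _ x : ⋀[ℂ]^p (Fin (n + 1) → ℂ)) : ExteriorAlgebra ℂ _) *
        ExteriorAlgebra.ι ℂ a
    rw [coe_exteriorPower_map, map_mul_ι_eq]
  have hker : Module.finrank ℂ (LinearMap.ker φ) = n := by
    have := Module.Dual.finrank_ker_add_one_of_ne_zero hφ0
    rw [Module.finrank_fin_fun] at this
    omega
  rw [hfac]
  refine (Submodule.finrank_mono (LinearMap.range_comp_le_range _ _)).trans
    ((LinearMap.finrank_range_le _).trans ?_)
  rw [exteriorPower.finrank_eq, hker]

theorem finrank_range_youngFlattening_tmul_le (p n : ℕ) {B C : Type*} [AddCommGroup B] [Module ℂ B]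
    [AddCommGroup C] [Module ℂ C] [FiniteDimensional ℂ C] (a : Fin (n + 1) → ℂ) (b : B) (c : C) :
    Module.finrank ℂ (LinearMap.range
      (youngFlattening (Fin (n + 1) → ℂ) B C p (a ⊗ₜ[ℂ] (b ⊗ₜ[ℂ] c)))) ≤ n.choose p := by
  have h : LinearMap.range (youngFlattening (Fin (n + 1) → ℂ) B C p (a ⊗ₜ[ℂ] (b ⊗ₜ[ℂ] c))) ≤
      (LinearMap.range (wedgeRight (Fin (n + 1) → ℂ) p a)).map
        ((TensorProduct.mk ℂ (⋀[ℂ]^(p + 1) (Fin (n + 1) → ℂ)) C).flip c) := by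
    rintro _ ⟨x, rfl⟩
    induction x using TensorProduct.induction_on with
    | zero => rw [map_zero]; exact Submodule.zero_mem _
    | add x y hx hy => rw [map_add]; exact Submodule.add_mem _ hx hy
    | tmul ω β =>
      rw [youngFlattening_tmul, TensorProduct.tmul_smul]
      exact Submodule.smul_mem _ _ (Submodule.mem_map_of_mem (LinearMap.mem_range_self _ _))
  exact (Submodule.finrank_mono h).trans
    ((Submodule.finrank_map_le _ _).trans (finrank_range_wedgeRight_le p n a))

theorem finrank_range_youngFlattening_le (p n : ℕ) {b c r : ℕ} {T : TensorSpace (n + 1) b c}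
    (hT : T ∈ rankLE (n + 1) b c r) :
    Module.finrank ℂ (LinearMap.range (youngFlattening _ _ _ p T)) ≤ r * n.choose p := by
  obtain ⟨x, y, z, rfl⟩ := hT
  have h := finrank_range_map_sum_le (K := ℂ)
    (V := ⋀[ℂ]^p (Fin (n + 1) → ℂ) ⊗[ℂ] Module.Dual ℂ (Fin b → ℂ))
    (W := ⋀[ℂ]^(p + 1) (Fin (n + 1) → ℂ) ⊗[ℂ] (Fin c → ℂ))
    (youngFlattening (Fin (n + 1) → ℂ) (Fin b → ℂ) (Fin c → ℂ) p)
    (fun i => x i ⊗ₜ[ℂ] (y i ⊗ₜ[ℂ] z i)) (N := n.choose p)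
  exact h fun i => finrank_range_youngFlattening_tmul_le p n _ _ _

/-! ### Maximal minors -/

section Minors

variable {K V W ι κ : Type*} [Field K] [AddCommMonoid V] [Module K V] [AddCommMonoid W] [Module K W]
  [Fintype ι] [DecidableEq ι] [Fintype κ]

theorem injective_of_det_submatrix_ne_zero (bV : Module.Basis ι K V) (bW : Module.Basis κ K W)
    (g : V →ₗ[K] W) (f : ι → κ) (h : ((LinearMap.toMatrix bV bW g).submatrix f id).det ≠ 0) :
    Function.Injective g := by
  intro x y hxy
  have hmul : ∀ x, ((LinearMap.toMatrix bV bW g).submatrix f id).mulVec (bV.repr x) =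
      fun i => bW.repr (g x) (f i) := by
    intro x
    rw [← LinearMap.toMatrix_mulVec_repr bV bW g x]
    rfl
  have h1 : Function.Injective ((LinearMap.toMatrix bV bW g).submatrix f id).mulVec :=
    Matrix.mulVec_injective_iff_isUnit.2
      ((Matrix.isUnit_iff_isUnit_det _).2 (isUnit_iff_ne_zero.2 h))
  exact bV.repr.injective (DFunLike.coe_injective (h1 ((hmul x).trans (by rw [hxy, hmul y]))))

theorem eq_zero_of_toMatrix_mulVec_eq_zero (bV : Module.Basis ι K V) (bW : Module.Basis κ K W)
    {g : V →ₗ[K] W} (h : Function.Injective g) {v : ι → K}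
    (hv : (LinearMap.toMatrix bV bW g).mulVec v = 0) : v = 0 := by
  have h1 := LinearMap.toMatrix_mulVec_repr bV bW g (bV.equivFun.symm v)
  rw [← Module.Basis.equivFun_apply bV, LinearEquiv.apply_symm_apply] at h1
  have h2 := (LinearEquiv.map_eq_zero_iff _).1 (DFunLike.coe_injective (h1.symm.trans hv))
  exact (LinearEquiv.map_eq_zero_iff _).1 (h (h2.trans (map_zero g).symm))

end Minors

theorem injective_flattening_of_maximalMinor_ne_zero {a b c p : ℕ} {T : TensorSpace a b c}
    {f : FlatCol a b p ↪ FlatRow a c p} (h : maximalMinor p T f ≠ 0) :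
    Function.Injective (youngFlattening _ _ _ p T) :=
  injective_of_det_submatrix_ne_zero _ _ _ _ h

theorem flatMatrix_mulVec_eq_zero {a b c p : ℕ} {T : TensorSpace a b c}
    (h : Function.Injective (youngFlattening _ _ _ p T)) {v : FlatCol a b p → ℂ}
    (hv : (flatMatrix p T).mulVec v = 0) : v = 0 :=
  eq_zero_of_toMatrix_mulVec_eq_zero _ _ h hv

/-- An injective flattening has a nonzero maximal minor. -/
theorem exists_maximalMinor_ne_zero {a b c p : ℕ} {T : TensorSpace a b c}
    (h : Function.Injective (youngFlattening _ _ _ p T)) : ∃ f, maximalMinor p T f ≠ 0 := by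
  set M := flatMatrix p T with hM
  have hrank : M.rank = Fintype.card (FlatCol a b p) := by
    have hinj : LinearMap.ker M.mulVecLin = ⊥ := LinearMap.ker_eq_bot'.2 fun v hv =>
      flatMatrix_mulVec_eq_zero h hv
    have := LinearMap.finrank_range_add_finrank_ker M.mulVecLin
    rw [hinj, finrank_bot, add_zero, Module.finrank_fintype_fun_eq_card] at this
    exact this
  obtain ⟨κ, e, he, hspan, hli⟩ := exists_linearIndependent' ℂ M.row
  have : Fintype κ := Fintype.ofInjective e he
  have hcard : Fintype.card κ = Fintype.card (FlatCol a b p) := by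
    rw [← hrank, Matrix.rank_eq_finrank_span_row, ← hspan, finrank_span_eq_card hli]
  obtain ⟨g⟩ := Fintype.card_eq.1 hcard
  refine ⟨⟨e ∘ g.symm, he.comp g.symm.injective⟩, ?_⟩
  have h1 : LinearIndependent ℂ (M.submatrix (e ∘ g.symm) id).row :=
    hli.comp g.symm g.symm.injective
  rw [Matrix.linearIndependent_rows_iff_isUnit, Matrix.isUnit_iff_isUnit_det] at h1
  exact h1.ne_zero

/-- For a square flattening all the maximal minors agree up to sign. -/
theorem maximalMinor_ne_zero {a b c p : ℕ} {T : TensorSpace a b c}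
    (h : Function.Injective (youngFlattening _ _ _ p T))
    (hcard : Fintype.card (FlatCol a b p) = Fintype.card (FlatRow a c p))
    (f : FlatCol a b p ↪ FlatRow a c p) : maximalMinor p T f ≠ 0 := by
  intro h0
  obtain ⟨v, hv, hv0⟩ := Matrix.exists_mulVec_eq_zero_iff.2 h0
  refine hv (flatMatrix_mulVec_eq_zero h ?_)
  have hf : Function.Surjective f :=
    ((Fintype.bijective_iff_injective_and_card f).2 ⟨f.injective, hcard⟩).2
  ext i
  obtain ⟨j, rfl⟩ := hf i
  exact congrFun hv0 j

theorem finrank_flatCol (a b p : ℕ) :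
    Module.finrank ℂ (⋀[ℂ]^p (Fin a → ℂ) ⊗[ℂ] Module.Dual ℂ (Fin b → ℂ)) = a.choose p * b := by
  rw [Module.finrank_tensorProduct, exteriorPower.finrank_eq, Module.finrank_fin_fun,
    Subspace.dual_finrank_eq, Module.finrank_fin_fun]

theorem card_flatRow_middle (p : ℕ) :
    Fintype.card (FlatCol (2 * p + 1) (2 * p + 1) p) =
      Fintype.card (FlatRow (2 * p + 1) (2 * p + 1) p) := by
  rw [Fintype.card_prod, Fintype.card_prod,
    ← Module.finrank_eq_card_basis ((stdBasis (2 * p + 1)).exteriorPower p),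
    ← Module.finrank_eq_card_basis ((stdBasis (2 * p + 1)).exteriorPower (p + 1)),
    finrank_exteriorPower_middle]

/-! ### Vanishing on tensors of low border rank -/

theorem continuous_maximalMinor {a b c : ℕ} (p : ℕ) (f : FlatCol a b p ↪ FlatRow a c p) :
    Continuous fun x => maximalMinor p ((tensorCoords a b c).symm x) f := by
  refine Continuous.matrix_det (continuous_matrix fun i j => ?_)
  exact LinearMap.continuous_of_finiteDimensional
    (Matrix.entryLinearMap ℂ ℂ (f i) j ∘ₗ
      (LinearMap.toMatrix (((stdBasis a).exteriorPower p).tensorProduct (stdBasis b).dualBasis)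
        (((stdBasis a).exteriorPower (p + 1)).tensorProduct (stdBasis c))).toLinearMap ∘ₗ
      youngFlattening _ _ _ p ∘ₗ (tensorCoords a b c).symm.toLinearMap)

/-- The maximal minors vanish on border rank at most `r` if `r C(n, p) < dim (Λ^p A ⊗ B*)`, where
`dim A = n + 1`. -/
theorem maximalMinor_eq_zero_of_borderRank {n b c p r : ℕ}
    (hr : r * n.choose p < (n + 1).choose p * b) {T : TensorSpace (n + 1) b c}
    (hT : T ∈ borderRankLE (n + 1) b c r) (f : FlatCol (n + 1) b p ↪ FlatRow (n + 1) c p) :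
    maximalMinor p T f = 0 := by
  have hclosed : IsClosed {x | maximalMinor p ((tensorCoords (n + 1) b c).symm x) f = 0} :=
    isClosed_eq (continuous_maximalMinor p f) continuous_const
  have hsub : tensorCoords (n + 1) b c '' rankLE (n + 1) b c r ⊆
      {x | maximalMinor p ((tensorCoords (n + 1) b c).symm x) f = 0} := by
    rintro _ ⟨S, hS, rfl⟩
    rw [Set.mem_ofPred_eq, LinearEquiv.symm_apply_apply]
    by_contra h0
    have h1 := LinearMap.finrank_range_of_inj (injective_flattening_of_maximalMinor_ne_zero h0)
    rw [finrank_flatCol] at h1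
    have h2 := finrank_range_youngFlattening_le p n hS
    omega
  have h := closure_minimal hsub hclosed hT
  rwa [Set.mem_ofPred_eq, LinearEquiv.symm_apply_apply] at h

/-- By `(p + 1) C(2p+1, p) = (2p + 1) C(2p, p)`, this is `4p (p + 1) < (2p + 1)²`. -/
theorem choose_lt_odd {p r : ℕ} (hr : r ≤ 2 * (2 * p + 1) - 2) :
    r * (2 * p).choose p < (2 * p + 1).choose p * (2 * p + 1) := by
  have h := Nat.add_one_mul_choose_eq (2 * p) p
  rw [← Nat.choose_symm_of_eq_add (show 2 * p + 1 = p + (p + 1) by ring)] at h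
  have hpos : 0 < (2 * p).choose p := Nat.choose_pos (by omega)
  refine lt_of_mul_lt_mul_right (a := p + 1) ?_ (Nat.zero_le _)
  calc r * (2 * p).choose p * (p + 1) ≤ (4 * p) * (2 * p).choose p * (p + 1) := by
        gcongr
        omega
    _ < (2 * p + 1) * ((2 * p + 1) * (2 * p).choose p) := by nlinarith
    _ = (2 * p + 1).choose p * (2 * p + 1) * (p + 1) := by rw [h]; ring

/-- By `(p + 2) C(2p+2, p) = (2p + 2) C(2p+1, p)`, this is `4p (p + 2) < (2p + 2)²`. -/
theorem choose_lt_even {p r : ℕ} (hr : r ≤ 2 * (2 * p + 2) - 4) :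
    r * (2 * p + 1).choose p < (2 * p + 2).choose p * (2 * p + 2) := by
  have h := Nat.add_one_mul_choose_eq (2 * p + 1) (p + 1)
  rw [← Nat.choose_symm_of_eq_add (show 2 * p + 1 = p + (p + 1) by ring),
    ← Nat.choose_symm_of_eq_add (show 2 * p + 1 + 1 = p + (p + 1 + 1) by ring)] at h
  have hpos : 0 < (2 * p + 1).choose p := Nat.choose_pos (by omega)
  refine lt_of_mul_lt_mul_right (a := p + 2) ?_ (Nat.zero_le _)
  calc r * (2 * p + 1).choose p * (p + 2) ≤ (4 * p) * (2 * p + 1).choose p * (p + 2) := by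
        gcongr
        omega
    _ < (2 * p + 2) * ((2 * p + 1 + 1) * (2 * p + 1).choose p) := by nlinarith
    _ = (2 * p + 2).choose p * (2 * p + 2) * (p + 2) := by rw [h]; ring

/-! ### The determinant of the commutator matrix -/

section BlockDeterminants

variable {R n : Type*} [CommRing R] [Fintype n] [DecidableEq n]

theorem det_fromBlocks_zero_one_one_zero :
    (Matrix.fromBlocks (0 : Matrix n n R) (1 : Matrix n n R) (1 : Matrix n n R) 0).det =
      (-1) ^ Fintype.card n := by
  have h : Matrix.fromBlocks (0 : Matrix n n R) (1 : Matrix n n R) (1 : Matrix n n R) 0 *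
      Matrix.fromBlocks (1 : Matrix n n R) 0 (1 : Matrix n n R) 1 =
      Matrix.fromBlocks (1 : Matrix n n R) (1 : Matrix n n R) (1 : Matrix n n R) 0 := by
    simp [Matrix.fromBlocks_multiply]
  have h' := congrArg Matrix.det h
  rw [Matrix.det_mul, Matrix.det_fromBlocks_zero₁₂, Matrix.det_one, mul_one, mul_one,
    Matrix.det_fromBlocks_one₁₁, Matrix.mul_one, zero_sub, Matrix.det_neg, Matrix.det_one,
    mul_one] at h'
  exact h'

theorem det_fromBlocks_zero_lower_right (A B C : Matrix n n R) :
    (Matrix.fromBlocks A B C 0).det = (-1) ^ Fintype.card n * B.det * C.det := by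
  have h : Matrix.fromBlocks B A 0 C *
      Matrix.fromBlocks (0 : Matrix n n R) (1 : Matrix n n R) (1 : Matrix n n R) 0 =
      Matrix.fromBlocks A B C 0 := by
    simp [Matrix.fromBlocks_multiply]
  rw [← h, Matrix.det_mul, Matrix.det_fromBlocks_zero₂₁, det_fromBlocks_zero_one_one_zero]
  ring

/-- A matrix that is block diagonal with respect to a grading of its indices. The values outside
the image of `key` contribute empty determinants. -/
theorem det_eq_prod_toSquareBlock (M : Matrix n n R) (key : n → ℤ)
    (h : ∀ x y, key x ≠ key y → M x y = 0) {s : Finset ℤ} (hs : ∀ x, key x ∈ s) :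
    M.det = ∏ d ∈ s, (M.toSquareBlock key d).det := by
  rw [Matrix.BlockTriangular.det (b := key) fun x y hxy => h x y (ne_of_gt hxy)]
  refine Finset.prod_subset ?_ ?_
  · intro d hd
    obtain ⟨x, _, rfl⟩ := Finset.mem_image.1 hd
    exact hs x
  · intro d _ hd
    have : IsEmpty {x // key x = d} :=
      ⟨fun x => hd (Finset.mem_image.2 ⟨x.1, Finset.mem_univ _, x.2⟩)⟩
    exact Matrix.det_isEmpty

end BlockDeterminants

theorem sliceX_mul_apply {m p : ℕ} (l : LambdaIndex m p → ℂ) {i : ℤ} (hi : 0 ≤ i)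
    (N : Matrix (Fin m) (Fin m) ℂ) (b c : Fin m) :
    (sliceX l i * N) b c = if h : (b : ℤ) + i < m then N ⟨(b + i).toNat, by omega⟩ c else 0 := by
  rw [Matrix.mul_apply]
  split_ifs with h
  · rw [Finset.sum_eq_single_of_mem ⟨((b : ℤ) + i).toNat, by omega⟩ (Finset.mem_univ _)]
    · rw [sliceX, Matrix.of_apply, if_pos (by simp only; omega), if_pos hi, one_mul]
    · intro e _ he
      rw [sliceX, Matrix.of_apply, if_neg, zero_mul]
      intro h'
      exact he (Fin.ext (by simp only; omega))
  · refine Finset.sum_eq_zero fun e _ => ?_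
    have := e.2
    rw [sliceX, Matrix.of_apply, if_neg (by omega), zero_mul]

theorem mul_sliceX_apply {m p : ℕ} (l : LambdaIndex m p → ℂ) {i : ℤ} (hi : 0 ≤ i)
    (N : Matrix (Fin m) (Fin m) ℂ) (b c : Fin m) :
    (N * sliceX l i) b c = if h : i ≤ c then N b ⟨(c - i).toNat, by omega⟩ else 0 := by
  rw [Matrix.mul_apply]
  split_ifs with h
  · rw [Finset.sum_eq_single_of_mem ⟨((c : ℤ) - i).toNat, by omega⟩ (Finset.mem_univ _)]
    · rw [sliceX, Matrix.of_apply, if_pos (by simp only; omega), if_pos hi, mul_one]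
    · intro e _ he
      rw [sliceX, Matrix.of_apply, if_neg, mul_zero]
      intro h'
      exact he (Fin.ext (by simp only; omega))
  · refine Finset.sum_eq_zero fun e _ => ?_
    rw [sliceX, Matrix.of_apply, if_neg (by omega), mul_zero]

theorem lie_sliceX_of_nonneg {m p : ℕ} (l : LambdaIndex m p → ℂ) {i j : ℤ} (hi : 0 ≤ i)
    (hj : 0 ≤ j) (b c : Fin m) : ⁅sliceX l i, sliceX l j⁆ b c = 0 := by
  rw [Ring.lie_def, Matrix.sub_apply, sliceX_mul_apply l hi, mul_sliceX_apply l hi, sub_eq_zero]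
  have hc := c.2
  split_ifs with h₁ h₂ h₂
  · simp only [sliceX, Matrix.of_apply, if_pos hj]
    congr 1
    rw [eq_iff_iff]
    omega
  · rw [sliceX, Matrix.of_apply, if_neg (by simp only; omega)]
  · rw [sliceX, Matrix.of_apply, if_neg (by simp only; omega)]
  · rfl

theorem lam_eq_zero {m p : ℕ} (l : LambdaIndex m p → ℂ) {k α : ℤ} (h : α < 1 ∨ (m : ℤ) < k + α) :
    lam l k α = 0 := by
  rw [lam, dif_neg (by omega)]

/-- The commutator of `X_i` and `X_{-k}`. The conditions for its entries to lie inside the matrices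
are absorbed by the convention that `λ` vanishes outside its range. -/
theorem lie_sliceX_neg {m p : ℕ} (l : LambdaIndex m p → ℂ) {i k : ℤ} (hi : 0 < i)
    (hk : 0 < k) (b c : Fin m) :
    ⁅sliceX l i, sliceX l (-k)⁆ b c =
      if (c : ℤ) = b + i - k then lam l k (c + 1) - lam l k (c + 1 - i) else 0 := by
  rw [Ring.lie_def, Matrix.sub_apply, sliceX_mul_apply l hi.le, mul_sliceX_apply l hi.le]
  have h1 : (if h : (b : ℤ) + i < m then sliceX l (-k) ⟨(b + i).toNat, by omega⟩ c else 0) =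
      if (c : ℤ) = b + i - k then lam l k (c + 1) else 0 := by
    split_ifs with h h' h'
    · rw [sliceX, Matrix.of_apply, if_pos (by simp only; omega), if_neg (by omega), neg_neg]
    · rw [sliceX, Matrix.of_apply, if_neg (by simp only; omega)]
    · rw [lam_eq_zero l (by omega)]
    · rfl
  have h2 : (if h : i ≤ c then sliceX l (-k) b ⟨(c - i).toNat, by omega⟩ else 0) =
      if (c : ℤ) = b + i - k then lam l k (c + 1 - i) else 0 := by
    split_ifs with h h' h'
    · rw [sliceX, Matrix.of_apply, if_pos (by simp only; omega), if_neg (by omega), neg_neg]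
      congr 1
      simp only
      omega
    · rw [sliceX, Matrix.of_apply, if_neg (by simp only; omega)]
    · rw [lam_eq_zero l (by omega)]
    · rfl
  rw [h1, h2]
  split_ifs
  · rfl
  · exact sub_zero 0

/-- The positive block indices `1, …, p`. -/
abbrev PosIndex (p : ℕ) : Type := ↥(Finset.Icc (1 : ℤ) p)

/-- The splitting of the block indices into the negative and the positive ones. -/
noncomputable def blockSplit (p m : ℕ) :
    (PosIndex p × Fin m) ⊕ (PosIndex p × Fin m) ≃ BlockIndex p × Fin m :=
  Equiv.ofBijective
    (Sum.elim
      (fun x => (⟨-x.1.1, by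
        have := Finset.mem_Icc.1 x.1.2
        rw [Finset.mem_erase, Finset.mem_Icc]
        omega⟩, x.2))
      (fun x => (⟨x.1.1, by
        have := Finset.mem_Icc.1 x.1.2
        rw [Finset.mem_erase, Finset.mem_Icc]
        omega⟩, x.2))) (by
    constructor
    · rintro (⟨⟨x, hx⟩, b⟩ | ⟨⟨x, hx⟩, b⟩) (⟨⟨y, hy⟩, c⟩ | ⟨⟨y, hy⟩, c⟩) h <;>
        rw [Finset.mem_Icc] at hx hy <;>
        simp only [Sum.elim_inl, Sum.elim_inr, Prod.mk.injEq, Subtype.mk.injEq] at h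
      · obtain rfl : x = y := by omega
        rw [h.2]
      · omega
      · omega
      · obtain rfl : x = y := h.1
        rw [h.2]
    · rintro ⟨⟨x, hx⟩, b⟩
      rw [Finset.mem_erase, Finset.mem_Icc] at hx
      rcases lt_or_gt_of_ne hx.1 with h | h
      · exact ⟨Sum.inl (⟨-x, Finset.mem_Icc.2 (by omega)⟩, b), by simp⟩
      · exact ⟨Sum.inr (⟨x, Finset.mem_Icc.2 (by omega)⟩, b), by simp⟩)

/-- The block of the commutators `[X_{-k}, X_i]`, `i, k > 0`. -/
noncomputable def upperBlock {m p : ℕ} (l : LambdaIndex m p → ℂ) :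
    Matrix (PosIndex p × Fin m) (PosIndex p × Fin m) ℂ :=
  Matrix.of fun x y => ⁅sliceX l (-x.1.1), sliceX l y.1.1⁆ x.2 y.2

/-- The block of the commutators `[X_i, X_{-k}]`, `i, k > 0`. -/
noncomputable def lowerBlock {m p : ℕ} (l : LambdaIndex m p → ℂ) :
    Matrix (PosIndex p × Fin m) (PosIndex p × Fin m) ℂ :=
  Matrix.of fun x y => ⁅sliceX l x.1.1, sliceX l (-y.1.1)⁆ x.2 y.2

theorem det_commutatorMatrix {m p : ℕ} (l : LambdaIndex m p → ℂ) :
    (commutatorMatrix l).det = (-1) ^ (p * m) * (upperBlock l).det * (lowerBlock l).det := by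
  have h : (commutatorMatrix l).submatrix (blockSplit p m) (blockSplit p m) =
      Matrix.fromBlocks
        (Matrix.of fun x y : PosIndex p × Fin m => ⁅sliceX l (-x.1.1), sliceX l (-y.1.1)⁆ x.2 y.2)
        (upperBlock l) (lowerBlock l) 0 := by
    ext x y
    rcases x with x | x <;> rcases y with y | y
    · rfl
    · rfl
    · rfl
    · exact lie_sliceX_of_nonneg l (i := x.1.1) (j := y.1.1)
        (by have := Finset.mem_Icc.1 x.1.2; omega)
        (by have := Finset.mem_Icc.1 y.1.2; omega) _ _
  rw [← Matrix.det_submatrix_equiv_self (blockSplit p m), h, det_fromBlocks_zero_lower_right,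
    Fintype.card_prod, Fintype.card_fin, Fintype.card_coe, Int.card_Icc, add_sub_cancel_right,
    Int.toNat_natCast]

/-- The pairs `(t, b)` with `b + 1 - t = d` correspond to the row and column indices of `D_d`. -/
noncomputable def diffKeyEquiv (m p : ℕ) (d : ℤ) :
    ↥(Finset.Icc (max 1 (1 - d)) (min (p : ℤ) (m - d))) ≃
      {x : PosIndex p × Fin m // (x.2 : ℤ) + 1 - x.1.1 = d} where
  toFun t := ⟨(⟨t.1, by have := Finset.mem_Icc.1 t.2; rw [Finset.mem_Icc]; omega⟩,
    ⟨(d + t.1 - 1).toNat, by have := Finset.mem_Icc.1 t.2; omega⟩), by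
      have := Finset.mem_Icc.1 t.2
      simp only
      omega⟩
  invFun x := ⟨x.1.1.1, by
    have := Finset.mem_Icc.1 x.1.1.2
    have := x.1.2.2
    have := x.2
    rw [Finset.mem_Icc]
    omega⟩
  left_inv t := rfl
  right_inv x := by
    have := x.2
    refine Subtype.ext (Prod.ext rfl (Fin.ext ?_))
    simp only
    omega

/-- The pairs `(t, b)` with `b + 1 + t = s` correspond to the row and column indices of `U_s`. -/
noncomputable def sumKeyEquiv (m p : ℕ) (s : ℤ) :
    ↥(Finset.Icc (max 1 (s - m)) (min (p : ℤ) (s - 1))) ≃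
      {x : PosIndex p × Fin m // (x.2 : ℤ) + 1 + x.1.1 = s} where
  toFun t := ⟨(⟨t.1, by have := Finset.mem_Icc.1 t.2; rw [Finset.mem_Icc]; omega⟩,
    ⟨(s - t.1 - 1).toNat, by have := Finset.mem_Icc.1 t.2; omega⟩), by
      have := Finset.mem_Icc.1 t.2
      simp only
      omega⟩
  invFun x := ⟨x.1.1.1, by
    have := Finset.mem_Icc.1 x.1.1.2
    have := x.1.2.2
    have := x.2
    rw [Finset.mem_Icc]
    omega⟩
  left_inv t := rfl
  right_inv x := by
    have := x.2
    refine Subtype.ext (Prod.ext rfl (Fin.ext ?_))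
    simp only
    omega

theorem det_upperBlock {m p : ℕ} (l : LambdaIndex m p → ℂ) {s : Finset ℤ}
    (hs : ∀ t b : ℤ, 1 ≤ t → t ≤ p → 0 ≤ b → b < m → b + 1 - t ∈ s) :
    (upperBlock l).det = ∏ d ∈ s, (smallD l d).det := by
  have hentry : ∀ x y : PosIndex p × Fin m, upperBlock l x y =
      if (x.2 : ℤ) + 1 - x.1.1 = y.2 + 1 - y.1.1 then
        lam l x.1.1 (y.2 + 1 - y.1.1) - lam l x.1.1 (y.2 + 1) else 0 := by
    intro x y
    have hx := Finset.mem_Icc.1 x.1.2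
    have hy := Finset.mem_Icc.1 y.1.2
    have hskew : upperBlock l x y = -⁅sliceX l y.1.1, sliceX l (-x.1.1)⁆ x.2 y.2 := by
      rw [upperBlock, Matrix.of_apply, Ring.lie_def, Ring.lie_def, Matrix.sub_apply,
        Matrix.sub_apply, neg_sub]
    rw [hskew, lie_sliceX_neg l (by omega) (by omega)]
    split_ifs with h h' h'
    · rw [neg_sub]
    · omega
    · omega
    · exact neg_zero
  rw [det_eq_prod_toSquareBlock (upperBlock l) (fun x => (x.2 : ℤ) + 1 - x.1.1)
    (fun x y hxy => by rw [hentry, if_neg hxy]) (s := s) fun x => hs _ _ (Finset.mem_Icc.1 x.1.2).1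
      (Finset.mem_Icc.1 x.1.2).2 (by omega) (by have := x.2.2; omega)]
  refine Finset.prod_congr rfl fun d _ => ?_
  rw [← Matrix.det_submatrix_equiv_self (diffKeyEquiv m p d)]
  congr 1
  ext k i
  have hk := Finset.mem_Icc.1 k.2
  have hi := Finset.mem_Icc.1 i.2
  have h1 : ((((d + i.1 - 1).toNat : ℕ) : ℤ)) = d + i.1 - 1 := by omega
  have h2 : ((((d + k.1 - 1).toNat : ℕ) : ℤ)) = d + k.1 - 1 := by omega
  simp only [Matrix.submatrix_apply, Matrix.toSquareBlock_def, Matrix.of_apply, hentry,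
    diffKeyEquiv, Equiv.coe_fn_mk, smallD, h1, h2]
  rw [if_pos (by ring)]
  congr 2 <;> ring

theorem det_lowerBlock {m p : ℕ} (l : LambdaIndex m p → ℂ) {s : Finset ℤ}
    (hs : ∀ t b : ℤ, 1 ≤ t → t ≤ p → 0 ≤ b → b < m → b + 1 + t ∈ s) :
    (lowerBlock l).det = ∏ d ∈ s, (smallU l d).det := by
  have hentry : ∀ x y : PosIndex p × Fin m, lowerBlock l x y =
      if (x.2 : ℤ) + 1 + x.1.1 = y.2 + 1 + y.1.1 then
        lam l y.1.1 (y.2 + 1) - lam l y.1.1 (y.2 + 1 - x.1.1) else 0 := by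
    intro x y
    have hx := Finset.mem_Icc.1 x.1.2
    have hy := Finset.mem_Icc.1 y.1.2
    rw [lowerBlock, Matrix.of_apply, lie_sliceX_neg l (by omega) (by omega)]
    split_ifs with h h' h'
    · rfl
    · omega
    · omega
    · rfl
  rw [det_eq_prod_toSquareBlock (lowerBlock l) (fun x => (x.2 : ℤ) + 1 + x.1.1)
    (fun x y hxy => by rw [hentry, if_neg hxy]) (s := s) fun x => hs _ _ (Finset.mem_Icc.1 x.1.2).1
      (Finset.mem_Icc.1 x.1.2).2 (by omega) (by have := x.2.2; omega)]
  refine Finset.prod_congr rfl fun d _ => ?_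
  rw [← Matrix.det_submatrix_equiv_self (sumKeyEquiv m p d)]
  congr 1
  ext i k
  have hk := Finset.mem_Icc.1 k.2
  have hi := Finset.mem_Icc.1 i.2
  have h1 : ((((d - i.1 - 1).toNat : ℕ) : ℤ)) = d - i.1 - 1 := by omega
  have h2 : ((((d - k.1 - 1).toNat : ℕ) : ℤ)) = d - k.1 - 1 := by omega
  simp only [Matrix.submatrix_apply, Matrix.toSquareBlock_def, Matrix.of_apply, hentry,
    sumKeyEquiv, Equiv.coe_fn_mk, smallU, h1, h2]
  rw [if_pos (by ring)]
  congr 2 <;> ring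

theorem det_commutatorMatrix_eq_prod (p : ℕ) (l : LambdaIndex (2 * p + 1) p → ℂ) :
    (commutatorMatrix l).det =
      (-1) ^ p * (∏ d ∈ Finset.Icc (1 - (p : ℤ)) (2 * p), (smallD l d).det) *
        ∏ s ∈ Finset.Icc (2 : ℤ) (3 * p + 1), (smallU l s).det := by
  have hsign : (-1 : ℂ) ^ (p * (2 * p + 1)) = (-1) ^ p := by
    rw [show p * (2 * p + 1) = 2 * (p * p) + p by ring, pow_add, pow_mul, neg_one_sq, one_pow,
      one_mul]
  rw [det_commutatorMatrix, hsign,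
    det_upperBlock l (s := Finset.Icc (1 - (p : ℤ)) (2 * p)) fun t b _ _ _ _ => by
      rw [Finset.mem_Icc]; omega,
    det_lowerBlock l (s := Finset.Icc (2 : ℤ) (3 * p + 1)) fun t b _ _ _ _ => by
      rw [Finset.mem_Icc]; omega]

/-! ### The small determinants do not vanish identically -/

theorem lam_of_mem {m p : ℕ} (g : ℤ → ℤ → ℂ) {k α : ℤ}
    (h : (1 ≤ k ∧ k ≤ p) ∧ 1 ≤ α ∧ k + α ≤ m) :
    lam (fun x : LambdaIndex m p => g x.1.1 x.1.2) k α = g k α := by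
  rw [lam, dif_pos h]

theorem exists_det_smallD_ne_zero_of_nonpos {m p : ℕ} (hm : 2 * p ≤ m) {d : ℤ} (hd : d ≤ 0) :
    ∃ l : LambdaIndex m p → ℂ, (smallD l d).det ≠ 0 := by
  refine ⟨fun x => if x.1.2 = d + x.1.1 then 1 else 0, ?_⟩
  have h : smallD (fun x : LambdaIndex m p => if x.1.2 = d + x.1.1 then (1 : ℂ) else 0) d = -1 := by
    ext k i
    have hk := Finset.mem_Icc.1 k.2
    have hi := Finset.mem_Icc.1 i.2
    rw [smallD, Matrix.of_apply, lam_eq_zero _ (by omega), zero_sub, Matrix.neg_apply,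
      Matrix.one_apply]
    congr 1
    by_cases hki : k = i
    · subst hki
      rw [lam_of_mem (fun k α => if α = d + k then 1 else 0) (by omega), if_pos rfl, if_pos rfl]
    · have hne : (i.1 : ℤ) ≠ k.1 := fun h => hki (Subtype.ext h.symm)
      rw [if_neg hki]
      by_cases hr : (k.1 : ℤ) + (d + i.1) ≤ m
      · rw [lam_of_mem (fun k α => if α = d + k then 1 else 0) (by omega), if_neg (by omega)]
      · exact lam_eq_zero _ (by omega)
  rw [h, Matrix.det_neg, Matrix.det_one, mul_one]
  exact pow_ne_zero _ (neg_ne_zero.2 one_ne_zero)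

/-- For `d ≥ 1` put `n = m - d`. With suitable parameters, the row `k ≤ n - p` of `D_d` is minus
a unit vector and the row `k > n - p` is the indicator of the columns `i > n - k`. Reversing the
columns `i > n - p` makes this matrix lower triangular. -/
theorem exists_det_smallD_ne_zero_of_pos {m p : ℕ} {d : ℤ} (hd : 1 ≤ d) :
    ∃ l : LambdaIndex m p → ℂ, (smallD l d).det ≠ 0 := by
  set n : ℤ := m - d with hn
  set g : ℤ → ℤ → ℂ := fun k α =>
    if k ≤ n - p then (if α = d + k then 1 else 0) else 1 with hg
  refine ⟨fun x => g x.1.1 x.1.2, ?_⟩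
  set M := smallD (fun x : LambdaIndex m p => g x.1.1 x.1.2) d with hM
  set σ : Equiv.Perm ↥(Finset.Icc (max 1 (1 - d)) (min (p : ℤ) (m - d))) :=
    Function.Involutive.toPerm
      (fun k => ⟨if k.1 ≤ n - p then k.1 else n + 1 - k.1, by
        have hk := Finset.mem_Icc.1 k.2
        rw [Finset.mem_Icc]
        split_ifs <;> omega⟩)
      (fun k => by
        have hk := Finset.mem_Icc.1 k.2
        refine Subtype.ext ?_
        simp only
        split_ifs <;> omega) with hσ
  have hσ_apply : ∀ k, ((σ k).1 : ℤ) = if k.1 ≤ n - p then k.1 else n + 1 - k.1 := fun k => rfl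
  have hrow₁ : ∀ k i, k.1 ≤ n - p → M k i = if i = k then -1 else 0 := by
    intro k i h
    have hk := Finset.mem_Icc.1 k.2
    have hi := Finset.mem_Icc.1 i.2
    have h1 : lam (fun x : LambdaIndex m p => g x.1.1 x.1.2) k d = 0 := by
      rw [lam_of_mem g (by omega), hg]
      simp only
      rw [if_pos h, if_neg (by omega)]
    have h2 : lam (fun x : LambdaIndex m p => g x.1.1 x.1.2) k (d + i) =
        if i = k then 1 else 0 := by
      by_cases hik : i = k
      · subst hik
        rw [lam_of_mem g (by omega)]
        simp [hg, h]
      · have hne : (i.1 : ℤ) ≠ k.1 := fun h => hik (Subtype.ext h)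
        rw [if_neg hik]
        by_cases hr : (k.1 : ℤ) + (d + i.1) ≤ m
        · rw [lam_of_mem g (by omega), hg]
          simp only
          rw [if_pos h, if_neg (by omega)]
        · exact lam_eq_zero _ (by omega)
    rw [hM, smallD, Matrix.of_apply, h1, h2]
    split_ifs <;> simp
  have hrow₂ : ∀ k i, ¬ k.1 ≤ n - p → M k i = if n - k.1 < i.1 then 1 else 0 := by
    intro k i h
    have hk := Finset.mem_Icc.1 k.2
    have hi := Finset.mem_Icc.1 i.2
    have h1 : lam (fun x : LambdaIndex m p => g x.1.1 x.1.2) k d = 1 := by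
      rw [lam_of_mem g (by omega), hg]
      simp only
      rw [if_neg h]
    have h2 : lam (fun x : LambdaIndex m p => g x.1.1 x.1.2) k (d + i) =
        if n - k.1 < i.1 then 0 else 1 := by
      split_ifs with hik
      · exact lam_eq_zero _ (by omega)
      · rw [lam_of_mem g (by omega), hg]
        simp only
        rw [if_neg h]
    rw [hM, smallD, Matrix.of_apply, h1, h2]
    split_ifs <;> simp
  have htri : (M.submatrix id σ).IsLowerTriangular := by
    intro k j hkj
    have hkj' : k.1 < j.1 := hkj
    have hj := hσ_apply j
    have hj' := Finset.mem_Icc.1 j.2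
    rw [Matrix.submatrix_apply, id]
    by_cases h : k.1 ≤ n - p
    · rw [hrow₁ k _ h, if_neg]
      intro h'
      rw [h'] at hj
      split_ifs at hj <;> omega
    · rw [hrow₂ k _ h, if_neg]
      rw [hj]
      split_ifs <;> omega
  have hdet : (M.submatrix id σ).det ≠ 0 := by
    rw [Matrix.det_of_isLowerTriangular _ htri, Finset.prod_ne_zero_iff]
    intro k _
    have hk := hσ_apply k
    rw [Matrix.submatrix_apply, id]
    by_cases h : k.1 ≤ n - p
    · rw [hrow₁ k _ h, if_pos (Subtype.ext (by rw [hk, if_pos h]))]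
      exact neg_ne_zero.2 one_ne_zero
    · rw [hrow₂ k _ h, if_pos (by rw [hk, if_neg h]; omega)]
      exact one_ne_zero
  rw [Matrix.det_permute'] at hdet
  exact right_ne_zero_of_mul hdet

theorem exists_det_smallD_ne_zero {m p : ℕ} (hm : 2 * p ≤ m) (d : ℤ) :
    ∃ l : LambdaIndex m p → ℂ, (smallD l d).det ≠ 0 := by
  rcases le_or_gt d 0 with hd | hd
  · exact exists_det_smallD_ne_zero_of_nonpos hm hd
  · exact exists_det_smallD_ne_zero_of_pos hd

/-- The substitution `λ_{k,α} ↦ λ_{k,m+1-k-α}` turns `U_s` into the transpose of `D_{m+1-s}`. -/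
theorem exists_det_smallU_ne_zero {m p : ℕ} (hm : 2 * p ≤ m) (s : ℤ) :
    ∃ l : LambdaIndex m p → ℂ, (smallU l s).det ≠ 0 := by
  obtain ⟨l, hl⟩ := exists_det_smallD_ne_zero hm (m + 1 - s)
  refine ⟨fun x => lam l x.1.1 (m + 1 - x.1.1 - x.1.2), ?_⟩
  have hlam : ∀ k α : ℤ, lam (fun x : LambdaIndex m p => lam l x.1.1 (m + 1 - x.1.1 - x.1.2)) k α =
      lam l k (m + 1 - k - α) := by
    intro k α
    by_cases h : (1 ≤ k ∧ k ≤ p) ∧ 1 ≤ α ∧ k + α ≤ m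
    · exact lam_of_mem (fun k α => lam l k (m + 1 - k - α)) h
    · rw [lam, dif_neg h, lam, dif_neg (by omega)]
  set e : ↥(Finset.Icc (max 1 (s - m)) (min (p : ℤ) (s - 1))) ≃
      ↥(Finset.Icc (max 1 (1 - ((m : ℤ) + 1 - s))) (min (p : ℤ) (m - (m + 1 - s)))) :=
    Equiv.subtypeEquivRight fun t => by rw [Finset.mem_Icc, Finset.mem_Icc]; omega with he
  have h : smallU (fun x : LambdaIndex m p => lam l x.1.1 (m + 1 - x.1.1 - x.1.2)) s =
      ((smallD l (m + 1 - s)).submatrix e e).transpose := by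
    ext i k
    rw [smallU, Matrix.of_apply, hlam, hlam, Matrix.transpose_apply, Matrix.submatrix_apply, smallD,
      Matrix.of_apply]
    change _ = lam l k.1 (m + 1 - s) - lam l k.1 (m + 1 - s + i.1)
    congr 2 <;> ring
  rw [h, Matrix.det_transpose, Matrix.det_submatrix_equiv_self]
  exact hl

/-! ### Polynomial functions of the parameters -/

/-- A function on `ℂ^σ` that is given by a polynomial. -/
def IsPolynomialFun {σ : Type*} (h : (σ → ℂ) → ℂ) : Prop :=
  ∃ F : MvPolynomial σ ℂ, ∀ l, MvPolynomial.eval l F = h l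

namespace IsPolynomialFun

variable {σ : Type*} {g h : (σ → ℂ) → ℂ}

theorem const (z : ℂ) : IsPolynomialFun fun _ : σ → ℂ => z :=
  ⟨MvPolynomial.C z, fun _ => MvPolynomial.eval_C z⟩

theorem mul (hg : IsPolynomialFun g) (hh : IsPolynomialFun h) :
    IsPolynomialFun fun l => g l * h l := by
  obtain ⟨G, hG⟩ := hg
  obtain ⟨H, hH⟩ := hh
  exact ⟨G * H, fun l => by rw [map_mul, hG, hH]⟩

theorem sub (hg : IsPolynomialFun g) (hh : IsPolynomialFun h) :
    IsPolynomialFun fun l => g l - h l := by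
  obtain ⟨G, hG⟩ := hg
  obtain ⟨H, hH⟩ := hh
  exact ⟨G - H, fun l => by rw [map_sub, hG, hH]⟩

theorem sum {ι : Type*} (s : Finset ι) {g : ι → (σ → ℂ) → ℂ} (hg : ∀ i, IsPolynomialFun (g i)) :
    IsPolynomialFun fun l => ∑ i ∈ s, g i l := by
  choose G hG using hg
  exact ⟨∑ i ∈ s, G i, fun l => by rw [map_sum]; exact Finset.sum_congr rfl fun i _ => hG i l⟩

theorem det {ι : Type*} [Fintype ι] [DecidableEq ι] {M : (σ → ℂ) → Matrix ι ι ℂ}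
    (hM : ∀ i j, IsPolynomialFun fun l => M l i j) : IsPolynomialFun fun l => (M l).det := by
  choose G hG using hM
  refine ⟨(Matrix.of G).det, fun l => ?_⟩
  rw [RingHom.map_det]
  congr 1
  ext i j
  exact hG i j l

end IsPolynomialFun

theorem isPolynomialFun_lam {m p : ℕ} (k α : ℤ) :
    IsPolynomialFun fun l : LambdaIndex m p → ℂ => lam l k α := by
  by_cases h : (1 ≤ k ∧ k ≤ p) ∧ 1 ≤ α ∧ k + α ≤ m
  · exact ⟨MvPolynomial.X ⟨(k, α), h⟩, fun l => by
      have hl : lam l k α = l ⟨(k, α), h⟩ := dif_pos h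
      exact (MvPolynomial.eval_X _).trans hl.symm⟩
  · exact ⟨0, fun l => by
      have hl : lam l k α = 0 := dif_neg h
      exact (map_zero _).trans hl.symm⟩

theorem isPolynomialFun_sliceX {m p : ℕ} (j : ℤ) (b c : Fin m) :
    IsPolynomialFun fun l : LambdaIndex m p → ℂ => sliceX l j b c := by
  simp only [sliceX, Matrix.of_apply]
  split_ifs
  · exact IsPolynomialFun.const 1
  · exact isPolynomialFun_lam _ _
  · exact IsPolynomialFun.const 0

theorem isPolynomialFun_det_smallD {m p : ℕ} (d : ℤ) :
    IsPolynomialFun fun l : LambdaIndex m p → ℂ => (smallD l d).det :=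
  IsPolynomialFun.det fun _ _ => (isPolynomialFun_lam _ _).sub (isPolynomialFun_lam _ _)

theorem isPolynomialFun_det_smallU {m p : ℕ} (s : ℤ) :
    IsPolynomialFun fun l : LambdaIndex m p → ℂ => (smallU l s).det :=
  IsPolynomialFun.det fun _ _ => (isPolynomialFun_lam _ _).sub (isPolynomialFun_lam _ _)

theorem isPolynomialFun_maximalMinor {m p : ℕ}
    (f : FlatCol (2 * p + 1) m p ↪ FlatRow (2 * p + 1) m p) :
    IsPolynomialFun fun l : LambdaIndex m p → ℂ => maximalMinor p (tensorT l) f := by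
  refine IsPolynomialFun.det fun i j => ?_
  have h : ∀ l : LambdaIndex m p → ℂ, (flatMatrix p (tensorT l)).submatrix f id i j =
      ∑ a : Fin (2 * p + 1), ∑ b : Fin m, ∑ c : Fin m, sliceX l ((a : ℤ) - p) b c *
        flatMatrix p (stdBasis (2 * p + 1) a ⊗ₜ[ℂ] (stdBasis m b ⊗ₜ[ℂ] stdBasis m c)) (f i) j := by
    intro l
    simp only [flatMatrix, tensorT, TensorProduct.tmul_sum, TensorProduct.tmul_smul, map_sum,
      map_smul, Matrix.submatrix_apply, id, Matrix.sum_apply, Matrix.smul_apply, smul_eq_mul]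
  simp only [h]
  exact IsPolynomialFun.sum _ fun a => IsPolynomialFun.sum _ fun b => IsPolynomialFun.sum _ fun c =>
    (isPolynomialFun_sliceX _ b c).mul (IsPolynomialFun.const _)

/-! ### The equations for border rank -/

theorem theorem1p2 (p : ℕ) :
    -- `m = 2p + 1`: the maximal minors vanish on border rank at most `r`, for all `r ≤ 2m - 2`,
    -- and they do not all vanish identically
    ((∀ r : ℕ, r ≤ 2 * (2 * p + 1) - 2 →
        ∀ T ∈ borderRankLE (2 * p + 1) (2 * p + 1) (2 * p + 1) r,
          ∀ f, maximalMinor p T f = 0) ∧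
      (∃ T : TensorSpace (2 * p + 1) (2 * p + 1) (2 * p + 1), ∃ f, maximalMinor p T f ≠ 0)) ∧
    -- `m = 2p + 2`: the same for all `r ≤ 2m - 4`
    ((∀ r : ℕ, r ≤ 2 * (2 * p + 2) - 4 →
        ∀ T ∈ borderRankLE (2 * p + 2) (2 * p + 2) (2 * p + 2) r,
          ∀ f, maximalMinor p T f = 0) ∧
      (∃ T : TensorSpace (2 * p + 2) (2 * p + 2) (2 * p + 2), ∃ f, maximalMinor p T f ≠ 0)) ∧
    -- `m = 2p + 1`: the determinant of the commutator matrix of `T_m(λ)` factors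
    (∀ l : LambdaIndex (2 * p + 1) p → ℂ,
      (commutatorMatrix l).det =
        (-1) ^ p * (∏ d ∈ Finset.Icc (1 - (p : ℤ)) (2 * p), (smallD l d).det) *
          ∏ s ∈ Finset.Icc (2 : ℤ) (3 * p + 1), (smallU l s).det) ∧
    -- `m = 2p + 1`: for generic `λ` no small minor vanishes, and no maximal minor of `T_m(λ)` does
    (∃ F : MvPolynomial (LambdaIndex (2 * p + 1) p) ℂ, F ≠ 0 ∧
      ∀ l : LambdaIndex (2 * p + 1) p → ℂ, MvPolynomial.eval l F ≠ 0 →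
        (∀ d ∈ Finset.Icc (1 - (p : ℤ)) (2 * p), (smallD l d).det ≠ 0) ∧
        (∀ s ∈ Finset.Icc (2 : ℤ) (3 * p + 1), (smallU l s).det ≠ 0) ∧
        (commutatorMatrix l).det ≠ 0 ∧
        ∀ f, maximalMinor p (tensorT l) f ≠ 0) := by
  obtain ⟨l₀, hl₀⟩ := exists_injective_youngFlattening_odd p
  obtain ⟨f₀, hf₀⟩ := exists_maximalMinor_ne_zero hl₀
  refine ⟨⟨fun r hr T hT f => maximalMinor_eq_zero_of_borderRank (choose_lt_odd hr) hT f,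
    tensorT l₀, f₀, hf₀⟩, ⟨fun r hr T hT f =>
      maximalMinor_eq_zero_of_borderRank (choose_lt_even hr) hT f, ?_⟩,
    det_commutatorMatrix_eq_prod p, ?_⟩
  · obtain ⟨T, hT⟩ := exists_injective_youngFlattening_even p
    exact ⟨T, exists_maximalMinor_ne_zero hT⟩
  · obtain ⟨G, hG⟩ := isPolynomialFun_maximalMinor f₀
    choose D hD using fun d => isPolynomialFun_det_smallD (m := 2 * p + 1) (p := p) d
    choose U hU using fun s => isPolynomialFun_det_smallU (m := 2 * p + 1) (p := p) s
    have hG0 : G ≠ 0 := by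
      rintro rfl
      exact hf₀ ((hG l₀).symm.trans (map_zero _))
    have hD0 : ∀ d, D d ≠ 0 := by
      intro d h
      obtain ⟨l, hl⟩ := exists_det_smallD_ne_zero (m := 2 * p + 1) (p := p) (by omega) d
      exact hl ((hD d l).symm.trans (by rw [h, map_zero]))
    have hU0 : ∀ s, U s ≠ 0 := by
      intro s h
      obtain ⟨l, hl⟩ := exists_det_smallU_ne_zero (m := 2 * p + 1) (p := p) (by omega) s
      exact hl ((hU s l).symm.trans (by rw [h, map_zero]))
    refine ⟨G * (∏ d ∈ Finset.Icc (1 - (p : ℤ)) (2 * p), D d) *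
      ∏ s ∈ Finset.Icc (2 : ℤ) (3 * p + 1), U s, mul_ne_zero (mul_ne_zero hG0
        (Finset.prod_ne_zero_iff.2 fun d _ => hD0 d)) (Finset.prod_ne_zero_iff.2 fun s _ => hU0 s),
      fun l hl => ?_⟩
    rw [map_mul, map_mul, map_prod, map_prod, hG] at hl
    simp only [hD, hU] at hl
    have h1 := Finset.prod_ne_zero_iff.1 (right_ne_zero_of_mul (left_ne_zero_of_mul hl))
    have h2 := Finset.prod_ne_zero_iff.1 (right_ne_zero_of_mul hl)
    refine ⟨h1, h2, ?_, maximalMinor_ne_zero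
      (injective_flattening_of_maximalMinor_ne_zero (left_ne_zero_of_mul (left_ne_zero_of_mul hl)))
      (card_flatRow_middle p)⟩
    rw [det_commutatorMatrix_eq_prod]
    exact mul_ne_zero (mul_ne_zero (pow_ne_zero _ (neg_ne_zero.2 one_ne_zero))
      (Finset.prod_ne_zero_iff.2 h1)) (Finset.prod_ne_zero_iff.2 h2)
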